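/- Identify $\mathbb{R}^2$ with $\mathbb{C}$ via $(x_1,x_2)\mapsto x_1+\mathrm{i}x_2$, and let $T\mathbb{S}^1=\{(x,\xi)\in\mathbb{R}^2\times\mathbb{S}^1:\langle x,\xi\rangle=0\}$; its points are exactly the pairs $(\mathrm{i}p\zeta,\zeta)$ with $p\in\mathbb{R}$ and $\zeta\in\mathbb{C}$, $|\zeta|=1$. Let $\mathcal{S}(T\mathbb{S}^1)$ be the space of smooth functions $\phi:T\mathbb{S}^1\to\mathbb{C}$ such that $\sup_{p,\theta\in\mathbb{R}}\bigl|p^a\,\partial_p^b\partial_\theta^c\,[\phi(\mathrm{i}pe^{\mathrm{i}\theta},e^{\mathrm{i}\theta})]\bigr|<\infty$ for all integers $a,b,c\ge 0$. For integers $k,\ell\ge 0$ let $\mathcal{S}(S^k\times S^\ell)$ be the space of $(k+\ell)$-tensor fields $f=(f_{i_1\dots i_k j_1\dots j_\ell})$ on $\mathbb{R}^2$ whose components are complex-valued Schwartz functions and which are symmetric in the first $k$ and in the last $\ell$ indices. The mixed ray transform of such an $f$ is $$L_{k,\ell}f(x,\xi)=\int_{-\infty}^{\infty}\ \sum_{i_1,\dots,i_k,\,j_1,\dots,j_\ell\in\{1,2\}}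 f_{i_1\dots i_k j_1\dots j_\ell}(x+t\xi)\,\xi_{i_1}\cdots\xi_{i_k}\,\eta_{j_1}\cdots\eta_{j_\ell}\,dt,\qquad (x,\xi)\in T\mathbb{S}^1,$$ where $\eta=\xi^\perp=(-\xi_2,\xi_1)$. **Theorem.** Let $k,\ell\ge 0$ be integers. Then $L_{k,\ell}$ maps $\mathcal{S}(S^k\times S^\ell)$ into $\mathcal{S}(T\mathbb{S}^1)$, and a function $\phi\in\mathcal{S}(T\mathbb{S}^1)$ belongs to the range of $L_{k,\ell}:\mathcal{S}(S^k\times S^\ell)\to\mathcal{S}(T\mathbb{S}^1)$ if and only if the following two conditions hold: (i) $\phi(\mathrm{i}p\zeta,-\zeta)=(-1)^{k+\ell}\phi(\mathrm{i}p\zeta,\zeta)$ for all $p\in\mathbb{R}$ and all $\zeta\in\mathbb{C}$ with $|\zeta|=1$; (ii) for every integer $r\ge 0$ there is a homogeneous polynomial $P_{k\ell r}$ of degree $k+\ell+r$ in two variables with complex coefficients such that $$\int_{\mathbb{R}}p^r\,\phi(\mathrm{i}p\zeta,\zeta)\,dp=P_{k\ell r}(\zeta,\bar\zeta)\qquad\text{for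 all }\zeta\in\mathbb{C}\text{ with }|\zeta|=1.$$ -/

import Mathlib

open MeasureTheory
open scoped ContDiff SchwartzMap ComplexConjugate

/-- The tangent bundle `T𝕊¹` of the unit circle, i.e. the pairs `(x, ξ)` with `|ξ| = 1` and
`⟨x, ξ⟩ = 0`. The plane `ℝ²` is identified with `ℂ` by `(x₁, x₂) ↦ x₁ + i x₂`; the real inner
product of `ℂ` is then the dot product. The pair `(x, ξ)` stands for the line `x + ℝ ξ`. -/
@[ext]
structure TangentCircle where
  base : ℂ
  dir : ℂ
  norm_dir : ‖dir‖ = 1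
  inner_base_dir : inner ℝ base dir = 0

namespace TangentCircle

/-- The point `(i p ζ, ζ)` of `T𝕊¹`, for `p ∈ ℝ` and `|ζ| = 1`. Every point has this form, for
exactly one `(p, ζ)`. -/
def ofParam (p : ℝ) (ζ : ℂ) (hζ : ‖ζ‖ = 1) : TangentCircle where
  base := Complex.I * p * ζ
  dir := ζ
  norm_dir := hζ
  inner_base_dir := by
    simp [Complex.inner]
    ring

/-- The same line with the opposite orientation: `(x, ξ) ↦ (x, -ξ)`. -/
def reverse (q : TangentCircle) : TangentCircle where
  base := q.base
  dir := -q.dir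
  norm_dir := by simpa using q.norm_dir
  inner_base_dir := by rw [inner_neg_right, q.inner_base_dir, neg_zero]

/-- The function `φ` on `T𝕊¹` in the global coordinates `(p, θ) ∈ ℝ × ℝ`, where `(p, θ)` stands for
the point `(i p e^{iθ}, e^{iθ})`; these coordinates are `2π`-periodic in `θ` and are local
diffeomorphisms onto `T𝕊¹`. -/
noncomputable def inCoords (φ : TangentCircle → ℂ) (y : ℝ × ℝ) : ℂ :=
  φ (ofParam y.1 (Complex.exp (y.2 * Complex.I)) (Complex.norm_exp_ofReal_mul_I y.2))

/-- `φ ∈ 𝓢(T𝕊¹)`: the function is smooth, and all its derivatives decay faster than any power of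
`|x| = |p|`, uniformly in the direction. -/
def IsSchwartz (φ : TangentCircle → ℂ) : Prop :=
  ContDiff ℝ ∞ (inCoords φ) ∧
    ∀ a n : ℕ, ∃ C : ℝ, ∀ p θ : ℝ,
      |p| ^ a * ‖iteratedFDeriv ℝ n (inCoords φ) (p, θ)‖ ≤ C

end TangentCircle

/-- The Schwartz space `𝓢(S^k × S^ℓ)` of `(k + ℓ)`-tensor fields on the plane that are symmetric in
the first `k` and in the last `ℓ` indices. The component of `f` with indices
`i₁ … i_k j₁ … j_ℓ` is `f i j`; the index values `1, 2` of the two coordinates are `0, 1 : Fin 2`. -/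
def SchwartzTensorField (k ℓ : ℕ) :
    Submodule ℂ ((Fin k → Fin 2) → (Fin ℓ → Fin 2) → 𝓢(ℂ, ℂ)) where
  carrier := {f | ∀ (σ : Equiv.Perm (Fin k)) (τ : Equiv.Perm (Fin ℓ)) (i : Fin k → Fin 2)
    (j : Fin ℓ → Fin 2), f (i ∘ σ) (j ∘ τ) = f i j}
  add_mem' := by
    intro f g hf hg σ τ i j
    simp only [Pi.add_apply, hf σ τ i j, hg σ τ i j]
  zero_mem' := by
    intro σ τ i j
    rfl
  smul_mem' := by
    intro c f hf σ τ i j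
    simp only [Pi.smul_apply, hf σ τ i j]

/-- The two coordinates of a vector of the plane. -/
def planeCoord (ξ : ℂ) : Fin 2 → ℝ := ![ξ.re, ξ.im]

/-- The mixed ray transform
`L f (x, ξ) = ∫ f_{i₁ … i_k j₁ … j_ℓ}(x + t ξ) ξ^{i₁} ⋯ ξ^{i_k} η^{j₁} ⋯ η^{j_ℓ} dt`, summed over
all indices, where `η = ξ^⊥ = (-ξ₂, ξ₁)`, which is `i ξ` in complex notation. -/
noncomputable def mixedRayTransform {k ℓ : ℕ} (f : SchwartzTensorField k ℓ) :
    TangentCircle → ℂ := fun q =>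
  ∫ t : ℝ, ∑ i : Fin k → Fin 2, ∑ j : Fin ℓ → Fin 2,
    f.1 i j (q.base + t * q.dir) *
      (∏ a : Fin k, (planeCoord q.dir (i a) : ℂ)) *
      (∏ b : Fin ℓ, (planeCoord (Complex.I * q.dir) (j b) : ℂ))

/-!
The necessity of the two conditions is a change of variables: reversing a line gives the parity, and
Fubini's theorem on the lines of direction `ζ` turns `∫ p^r (L f) dp` into integrals of the
components of `f` against `Im (w ζ̄)^r`, which is homogeneous of degree `r` in `ζ, ζ̄`
(`SchwartzMap.exists_moment_polynomial`).

For the sufficiency, put `N = k + ℓ`. In complex notation the contraction of a tensor with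
`ξ^k ⊗ η^ℓ` is a combination of the monomials `ζ^m ζ̄^(N-m)`, and each of them occurs
(`exists_tensor_monomial`); so the range consists of the sums `∑ ζ^m ζ̄^(N-m) R a_m`, where `R` is
the ray transform of functions. By the central slice theorem (`SchwartzMap.rayTransform_fourier`),
`R (𝓕 A)` is the Fourier transform in `s` of `A(i s ζ)`. Hence, if `g(s, ζ)` denotes the inverse
Fourier transform of `φ(ipζ, ζ)` in `p`, the task is to write `g(s, ζ) = ∑ ζ^m ζ̄^(N-m) A_m(i s ζ)`
with Schwartz functions `A_m` on the plane.

The moments of `φ` are the Taylor coefficients of `g` in `s` at `s = 0`. By the moment condition,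
the coefficient of order `r` is a polynomial of degree `N + r` in `ζ, ζ̄`, that is, `∑ ζ^m ζ̄^(N-m) q_{r,m}(ζ)` with
`q_{r,m}` homogeneous of degree `r`. Borel's lemma (`exists_schwartzMap_taylor`) provides functions
`b_m` with these homogeneous components as Taylor expansions at the origin. The difference
`H = g - ∑ ζ^m ζ̄^(N-m) b_m(i s ζ)` vanishes to infinite order at `s = 0`; by parity, `ζ^N H` depends
on `i s ζ` only, and such a function is smooth on the plane (`exists_schwartzMap_of_flat`), because
the factors `1/s` in polar derivatives do no harm to flat functions. It is added to `b_0`.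

All smoothness and decay statements, on the cylinder and on the plane, are reduced to one principle:
a class of functions that is closed under differentiation and whose members satisfy a weighted bound
consists of smooth functions all of whose derivatives satisfy such a bound
(`contDiff_of_closed_hasFDerivAt`, `bounded_iteratedFDeriv_of_closed_hasFDerivAt`).
-/

/-! ### Smoothness from closure under differentiation -/

section Generic

variable {E : Type*} [NormedAddCommGroup E] [NormedSpace ℝ E]

/-- A class of functions whose differentials have coefficients (with respect to two fixed linear
forms) in the class again consists of smooth functions. -/
theorem contDiff_of_closed_hasFDerivAt {X : (E → ℂ) → Prop} (L₁ L₂ : E →L[ℝ] ℂ)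
    (hX : ∀ F, X F → ∃ F₁ F₂, X F₁ ∧ X F₂ ∧ ∀ y, HasFDerivAt F (F₁ y • L₁ + F₂ y • L₂) y)
    {F : E → ℂ} (hF : X F) : ContDiff ℝ ∞ F := by
  rw [contDiff_infty]
  intro n
  induction n generalizing F with
  | zero =>
    obtain ⟨F₁, F₂, -, -, h⟩ := hX F hF
    exact contDiff_zero.2 (continuous_iff_continuousAt.2 fun y => (h y).continuousAt)
  | succ n ih =>
    obtain ⟨F₁, F₂, h₁, h₂, h⟩ := hX F hF
    exact contDiff_succ_iff_hasFDerivAt.2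
      ⟨_, ((ih h₁).smul contDiff_const).add ((ih h₂).smul contDiff_const), h⟩

/-- In a class as in `contDiff_of_closed_hasFDerivAt`, a weighted bound for all the functions is a
weighted bound for all the derivatives. -/
theorem bounded_iteratedFDeriv_of_closed_hasFDerivAt {X : (E → ℂ) → Prop} (L₁ L₂ : E →L[ℝ] ℂ)
    (hX : ∀ F, X F → ∃ F₁ F₂, X F₁ ∧ X F₂ ∧ ∀ y, HasFDerivAt F (F₁ y • L₁ + F₂ y • L₂) y)
    {W : E → ℝ} (hW : ∀ y, 0 ≤ W y) (hb : ∀ F, X F → ∃ C : ℝ, ∀ y, W y * ‖F y‖ ≤ C)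
    (n : ℕ) {F : E → ℂ} (hF : X F) : ∃ C : ℝ, ∀ y, W y * ‖iteratedFDeriv ℝ n F y‖ ≤ C := by
  induction n generalizing F with
  | zero => simpa using hb F hF
  | succ n ih =>
    obtain ⟨F₁, F₂, h₁, h₂, h⟩ := hX F hF
    obtain ⟨C₁, hC₁⟩ := ih h₁
    obtain ⟨C₂, hC₂⟩ := ih h₂
    have s₁ := contDiff_of_closed_hasFDerivAt L₁ L₂ hX h₁
    have s₂ := contDiff_of_closed_hasFDerivAt L₁ L₂ hX h₂
    let T : (E →L[ℝ] ℂ) → ℂ →L[ℝ] (E →L[ℝ] ℂ) := fun L =>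
      (ContinuousLinearMap.toSpanSingleton ℂ L).restrictScalars ℝ
    have hf : fderiv ℝ F = (T L₁ ∘ F₁) + (T L₂ ∘ F₂) := by
      funext y
      simp [(h y).fderiv, T]
    refine ⟨‖T L₁‖ * C₁ + ‖T L₂‖ * C₂, fun y => ?_⟩
    rw [← norm_iteratedFDeriv_fderiv, hf, iteratedFDeriv_add_apply
      (((T L₁).contDiff.comp s₁).of_le (mod_cast le_top)).contDiffAt
      (((T L₂).contDiff.comp s₂).of_le (mod_cast le_top)).contDiffAt]
    have e₁ := (T L₁).norm_iteratedFDeriv_comp_left (n := n) (x := y) s₁.contDiffAt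
      (mod_cast le_top)
    have e₂ := (T L₂).norm_iteratedFDeriv_comp_left (n := n) (x := y) s₂.contDiffAt
      (mod_cast le_top)
    calc _ ≤ W y * (‖T L₁‖ * ‖iteratedFDeriv ℝ n F₁ y‖ + ‖T L₂‖ * ‖iteratedFDeriv ℝ n F₂ y‖) :=
          mul_le_mul_of_nonneg_left ((norm_add_le _ _).trans (add_le_add e₁ e₂)) (hW y)
      _ = ‖T L₁‖ * (W y * ‖iteratedFDeriv ℝ n F₁ y‖)
          + ‖T L₂‖ * (W y * ‖iteratedFDeriv ℝ n F₂ y‖) := by ring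
      _ ≤ _ := by gcongr <;> simp [*]

end Generic

/-! ### Schwartz functions on the cylinder -/

/-- The Schwartz condition of `TangentCircle.IsSchwartz` for a function of `(p, θ) ∈ ℝ × ℝ`;
periodicity in `θ` is not included. -/
def CylSchwartz (H : ℝ × ℝ → ℂ) : Prop :=
  ContDiff ℝ ∞ H ∧
    ∀ a n : ℕ, ∃ C : ℝ, ∀ y : ℝ × ℝ, |y.1| ^ a * ‖iteratedFDeriv ℝ n H y‖ ≤ C

theorem TangentCircle.isSchwartz_iff (φ : TangentCircle → ℂ) :
    TangentCircle.IsSchwartz φ ↔ CylSchwartz (TangentCircle.inCoords φ) := by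
  simp [TangentCircle.IsSchwartz, CylSchwartz, Prod.forall]

/-- `G₁` and `G₂` are the partial derivatives of `G`, which is differentiable. -/
def HasPartials (G G₁ G₂ : ℝ × ℝ → ℂ) : Prop :=
  ∀ y, HasFDerivAt G (G₁ y • Complex.ofRealCLM.comp (ContinuousLinearMap.fst ℝ ℝ ℝ) +
    G₂ y • Complex.ofRealCLM.comp (ContinuousLinearMap.snd ℝ ℝ ℝ)) y

/-- The partial derivative in the first coordinate. -/
noncomputable def partialFst (G : ℝ × ℝ → ℂ) (y : ℝ × ℝ) : ℂ := fderiv ℝ G y (1, 0)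

/-- The partial derivative in the second coordinate. -/
noncomputable def partialSnd (G : ℝ × ℝ → ℂ) (y : ℝ × ℝ) : ℂ := fderiv ℝ G y (0, 1)

theorem hasPartials_of_differentiable {G : ℝ × ℝ → ℂ} (h : Differentiable ℝ G) :
    HasPartials G (partialFst G) (partialSnd G) := by
  intro y
  convert (h y).hasFDerivAt using 1
  ext <;> simp [partialFst, partialSnd]

theorem HasPartials.eq {G G₁ G₂ : ℝ × ℝ → ℂ} (h : HasPartials G G₁ G₂) :
    partialFst G = G₁ ∧ partialSnd G = G₂ := by
  constructor <;> funext y <;> simp [partialFst, partialSnd, (h y).fderiv]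

theorem HasPartials.mul {G G₁ G₂ H H₁ H₂ : ℝ × ℝ → ℂ} (hG : HasPartials G G₁ G₂)
    (hH : HasPartials H H₁ H₂) :
    HasPartials (fun y => G y * H y) (fun y => G₁ y * H y + G y * H₁ y)
      (fun y => G₂ y * H y + G y * H₂ y) := by
  intro y
  exact ((hG y).mul (hH y)).congr_fderiv (by ext <;> simp <;> ring)

theorem HasPartials.add {G G₁ G₂ H H₁ H₂ : ℝ × ℝ → ℂ} (hG : HasPartials G G₁ G₂)
    (hH : HasPartials H H₁ H₂) :
    HasPartials (fun y => G y + H y) (fun y => G₁ y + H₁ y) (fun y => G₂ y + H₂ y) := by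
  intro y
  exact ((hG y).add (hH y)).congr_fderiv (by ext <;> simp)

theorem hasPartials_const (c : ℂ) : HasPartials (fun _ => c) (fun _ => 0) (fun _ => 0) := by
  intro y
  exact (hasFDerivAt_const c y).congr_fderiv (by ext <;> simp)

theorem hasPartials_fst : HasPartials (fun y => (y.1 : ℂ)) (fun _ => 1) (fun _ => 0) := by
  intro y
  exact (Complex.ofRealCLM.comp (ContinuousLinearMap.fst ℝ ℝ ℝ)).hasFDerivAt.congr_fderiv
    (by ext <;> simp)

theorem hasPartials_snd : HasPartials (fun y => (y.2 : ℂ)) (fun _ => 0) (fun _ => 1) := by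
  intro y
  exact (Complex.ofRealCLM.comp (ContinuousLinearMap.snd ℝ ℝ ℝ)).hasFDerivAt.congr_fderiv
    (by ext <;> simp)

theorem HasPartials.cexp {G G₁ G₂ : ℝ × ℝ → ℂ} (hG : HasPartials G G₁ G₂) :
    HasPartials (fun y => Complex.exp (G y)) (fun y => Complex.exp (G y) * G₁ y)
      (fun y => Complex.exp (G y) * G₂ y) := by
  intro y
  exact (hG y).cexp.congr_fderiv (by ext <;> simp)

/-- The function `e^{iθ}` on the cylinder. -/
noncomputable def unitDir (y : ℝ × ℝ) : ℂ := Complex.exp (y.2 * Complex.I)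

theorem hasPartials_unitDir :
    HasPartials unitDir (fun _ => 0) (fun y => Complex.I * unitDir y) := by
  have h := (hasPartials_snd.mul (hasPartials_const Complex.I)).cexp
  simp only [mul_zero, zero_mul, add_zero, one_mul] at h
  simpa only [mul_comm Complex.I,
    show unitDir = fun y : ℝ × ℝ => Complex.exp (y.2 * Complex.I) from rfl] using h

theorem norm_unitDir (y : ℝ × ℝ) : ‖unitDir y‖ = 1 := Complex.norm_exp_ofReal_mul_I _

theorem conj_unitDir (y : ℝ × ℝ) : conj (unitDir y) = Complex.exp (-(y.2 * Complex.I)) := by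
  rw [unitDir, ← Complex.exp_conj]; simp

theorem unitDir_mul_conj (y : ℝ × ℝ) : unitDir y * conj (unitDir y) = 1 := by
  rw [Complex.mul_conj, Complex.normSq_eq_norm_sq, norm_unitDir]; simp

theorem hasPartials_conj_unitDir :
    HasPartials (fun y => conj (unitDir y)) (fun _ => 0)
      (fun y => -Complex.I * conj (unitDir y)) := by
  have := (hasPartials_snd.mul (hasPartials_const (-Complex.I))).cexp
  simpa [conj_unitDir, mul_comm, funext_iff] using this

/-- The functions obtained from those in `Y` by sums and by products with constants, with `p`, with
`e^{iθ}` and with `e^{-iθ}`. -/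
inductive CylSpan (Y : (ℝ × ℝ → ℂ) → Prop) : (ℝ × ℝ → ℂ) → Prop
  | base {G} : Y G → CylSpan Y G
  | add {G H} : CylSpan Y G → CylSpan Y H → CylSpan Y (fun y => G y + H y)
  | const_mul {G} (c : ℂ) : CylSpan Y G → CylSpan Y (fun y => c * G y)
  | fst_mul {G} : CylSpan Y G → CylSpan Y (fun y => y.1 * G y)
  | dir_mul {G} : CylSpan Y G → CylSpan Y (fun y => unitDir y * G y)
  | conj_mul {G} : CylSpan Y G → CylSpan Y (fun y => conj (unitDir y) * G y)

theorem CylSpan.hasPartials {Y : (ℝ × ℝ → ℂ) → Prop}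
    (hY : ∀ G, Y G → ∃ G₁ G₂, CylSpan Y G₁ ∧ CylSpan Y G₂ ∧ HasPartials G G₁ G₂)
    {G : ℝ × ℝ → ℂ} (hG : CylSpan Y G) :
    ∃ G₁ G₂, CylSpan Y G₁ ∧ CylSpan Y G₂ ∧ HasPartials G G₁ G₂ := by
  induction hG with
  | base h => exact hY _ h
  | add _ _ ih ih' =>
    obtain ⟨G₁, G₂, h₁, h₂, h⟩ := ih
    obtain ⟨H₁, H₂, k₁, k₂, k⟩ := ih'
    exact ⟨_, _, h₁.add k₁, h₂.add k₂, h.add k⟩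
  | const_mul c h₀ ih =>
    obtain ⟨G₁, G₂, h₁, h₂, h⟩ := ih
    refine ⟨_, _, h₁.const_mul c, h₂.const_mul c, ?_⟩
    simpa using (hasPartials_const c).mul h
  | fst_mul h₀ ih =>
    obtain ⟨G₁, G₂, h₁, h₂, h⟩ := ih
    refine ⟨_, _, h₀.add h₁.fst_mul, h₂.fst_mul, ?_⟩
    simpa using hasPartials_fst.mul h
  | dir_mul h₀ ih =>
    obtain ⟨G₁, G₂, h₁, h₂, h⟩ := ih
    refine ⟨_, _, h₁.dir_mul, (h₀.dir_mul.const_mul Complex.I).add h₂.dir_mul, ?_⟩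
    simpa [mul_assoc] using hasPartials_unitDir.mul h
  | conj_mul h₀ ih =>
    obtain ⟨G₁, G₂, h₁, h₂, h⟩ := ih
    refine ⟨_, _, h₁.conj_mul, (h₀.conj_mul.const_mul (-Complex.I)).add h₂.conj_mul, ?_⟩
    simpa [mul_assoc] using hasPartials_conj_unitDir.mul h

theorem CylSpan.decay {Y : (ℝ × ℝ → ℂ) → Prop}
    (hY : ∀ G, Y G → ∀ a : ℕ, ∃ C : ℝ, ∀ y : ℝ × ℝ, |y.1| ^ a * ‖G y‖ ≤ C)
    {G : ℝ × ℝ → ℂ} (hG : CylSpan Y G) (a : ℕ) :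
    ∃ C : ℝ, ∀ y : ℝ × ℝ, |y.1| ^ a * ‖G y‖ ≤ C := by
  induction hG generalizing a with
  | base h => exact hY _ h a
  | add _ _ ih ih' =>
    obtain ⟨C, hC⟩ := ih a
    obtain ⟨C', hC'⟩ := ih' a
    refine ⟨C + C', fun y => ?_⟩
    calc _ ≤ |y.1| ^ a * (_ + _) := mul_le_mul_of_nonneg_left (norm_add_le _ _) (by positivity)
      _ ≤ _ := by rw [mul_add]; exact add_le_add (hC y) (hC' y)
  | const_mul c _ ih =>
    obtain ⟨C, hC⟩ := ih a
    refine ⟨‖c‖ * C, fun y => ?_⟩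
    rw [norm_mul, mul_left_comm]
    exact mul_le_mul_of_nonneg_left (hC y) (norm_nonneg c)
  | fst_mul _ ih =>
    obtain ⟨C, hC⟩ := ih (a + 1)
    refine ⟨C, fun y => ?_⟩
    simpa [pow_succ, mul_assoc] using hC y
  | dir_mul _ ih =>
    obtain ⟨C, hC⟩ := ih a
    exact ⟨C, fun y => by simpa [norm_unitDir] using hC y⟩
  | conj_mul _ ih =>
    obtain ⟨C, hC⟩ := ih a
    exact ⟨C, fun y => by simpa [norm_unitDir] using hC y⟩

/-- If `Y` consists of rapidly decreasing functions with partial derivatives in `CylSpan Y`, then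
`CylSpan Y` consists of Schwartz functions on the cylinder. -/
theorem CylSpan.cylSchwartz {Y : (ℝ × ℝ → ℂ) → Prop}
    (hd : ∀ G, Y G → ∃ G₁ G₂, CylSpan Y G₁ ∧ CylSpan Y G₂ ∧ HasPartials G G₁ G₂)
    (hb : ∀ G, Y G → ∀ a : ℕ, ∃ C : ℝ, ∀ y : ℝ × ℝ, |y.1| ^ a * ‖G y‖ ≤ C)
    {G : ℝ × ℝ → ℂ} (hG : CylSpan Y G) : CylSchwartz G :=
  ⟨contDiff_of_closed_hasFDerivAt _ _ (fun _ h => h.hasPartials hd) hG, fun a n =>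
    bounded_iteratedFDeriv_of_closed_hasFDerivAt _ _ (fun _ h => h.hasPartials hd)
      (W := fun y => |y.1| ^ a) (fun y => by positivity) (fun _ h => h.decay hb a) n hG⟩

namespace CylSchwartz

variable {H : ℝ × ℝ → ℂ}

theorem differentiable (h : CylSchwartz H) : Differentiable ℝ H :=
  h.1.differentiable (by simp)

theorem continuous (h : CylSchwartz H) : Continuous H := h.1.continuous

theorem hasPartials (h : CylSchwartz H) : HasPartials H (partialFst H) (partialSnd H) :=
  hasPartials_of_differentiable h.differentiable

theorem decay (h : CylSchwartz H) (a : ℕ) : ∃ C : ℝ, ∀ y : ℝ × ℝ, |y.1| ^ a * ‖H y‖ ≤ C := by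
  simpa using h.2 a 0

theorem fderiv_apply (h : CylSchwartz H) (v : ℝ × ℝ) : CylSchwartz fun y => fderiv ℝ H y v := by
  have hs : ContDiff ℝ ∞ (fderiv ℝ H) := h.1.fderiv_right (by simp)
  refine ⟨hs.clm_apply contDiff_const, fun a n => ?_⟩
  obtain ⟨C, hC⟩ := h.2 a (n + 1)
  refine ⟨‖v‖ * C, fun y => ?_⟩
  have := norm_iteratedFDeriv_clm_apply_const (n := n) (c := v) (x := y) hs.contDiffAt
    (mod_cast le_top)
  rw [norm_iteratedFDeriv_fderiv] at this
  calc _ ≤ |y.1| ^ a * (‖v‖ * ‖iteratedFDeriv ℝ (n + 1) H y‖) :=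
        mul_le_mul_of_nonneg_left this (by positivity)
    _ = ‖v‖ * (|y.1| ^ a * ‖iteratedFDeriv ℝ (n + 1) H y‖) := by ring
    _ ≤ _ := mul_le_mul_of_nonneg_left (hC y) (norm_nonneg _)

theorem partialFst (h : CylSchwartz H) : CylSchwartz (partialFst H) := h.fderiv_apply _

theorem partialSnd (h : CylSchwartz H) : CylSchwartz (partialSnd H) := h.fderiv_apply _

theorem of_cylSpan (h : CylSpan CylSchwartz H) : CylSchwartz H :=
  h.cylSchwartz (fun _ hG => ⟨_, _, .base hG.partialFst, .base hG.partialSnd, hG.hasPartials⟩)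
    (fun _ hG => hG.decay)

theorem add {G : ℝ × ℝ → ℂ} (hG : CylSchwartz G) (h : CylSchwartz H) :
    CylSchwartz fun y => G y + H y := of_cylSpan (.add (.base hG) (.base h))

theorem const_mul (c : ℂ) (h : CylSchwartz H) : CylSchwartz fun y => c * H y :=
  of_cylSpan (.const_mul c (.base h))

theorem fst_mul (h : CylSchwartz H) : CylSchwartz fun y => y.1 * H y :=
  of_cylSpan (.fst_mul (.base h))

theorem dir_mul (h : CylSchwartz H) : CylSchwartz fun y => unitDir y * H y :=
  of_cylSpan (.dir_mul (.base h))

theorem conj_mul (h : CylSchwartz H) : CylSchwartz fun y => conj (unitDir y) * H y :=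
  of_cylSpan (.conj_mul (.base h))

theorem zero : CylSchwartz fun _ => 0 := by
  refine ⟨contDiff_const, fun a n => ⟨0, fun y => ?_⟩⟩
  have : iteratedFDeriv ℝ n (fun _ : ℝ × ℝ => (0 : ℂ)) = 0 := iteratedFDeriv_fun_zero
  simp [this]

theorem sum {ι : Type*} (s : Finset ι) {G : ι → ℝ × ℝ → ℂ} (h : ∀ i ∈ s, CylSchwartz (G i)) :
    CylSchwartz fun y => ∑ i ∈ s, G i y := by
  classical
  induction s using Finset.induction_on with
  | empty => simpa using zero
  | insert i s hi ih =>
    simp only [Finset.sum_insert hi]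
    exact (h i (by simp)).add (ih fun j hj => h j (by simp [hj]))

/-- A bound by an integrable function of `p`, uniform in `θ`. -/
theorem exists_integrable_bound (h : CylSchwartz H) :
    ∃ C : ℝ, 0 ≤ C ∧ ∀ y : ℝ × ℝ, ‖H y‖ ≤ C * (1 + y.1 ^ 2)⁻¹ := by
  obtain ⟨C₀, h₀⟩ := h.decay 0
  obtain ⟨C₂, h₂⟩ := h.decay 2
  have key : ∀ y : ℝ × ℝ, ‖H y‖ ≤ (C₀ + C₂) * (1 + y.1 ^ 2)⁻¹ := by
    intro y
    rw [← div_eq_mul_inv, le_div_iff₀ (by positivity)]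
    have := h₀ y; have := h₂ y
    simp only [pow_zero, one_mul, sq_abs] at *
    linarith
  refine ⟨C₀ + C₂, ?_, key⟩
  simpa using (norm_nonneg _).trans (key 0)

theorem integrable (h : CylSchwartz H) (θ : ℝ) : Integrable fun p : ℝ => H (p, θ) := by
  obtain ⟨C, -, hC⟩ := h.exists_integrable_bound
  refine (integrable_inv_one_add_sq.const_mul C).mono' ?_ (.of_forall fun p => hC (p, θ))
  exact (h.continuous.comp (by fun_prop)).aestronglyMeasurable

end CylSchwartz

/-! ### The partial Fourier transform on the cylinder -/

/-- The Fourier transform in `p`, with phase `e^{i c p s}`; the values `c = ∓2π` give the direct and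
the inverse transform. -/
noncomputable def oscTransform (c : ℝ) (H : ℝ × ℝ → ℂ) (y : ℝ × ℝ) : ℂ :=
  ∫ p : ℝ, Complex.exp (c * p * y.1 * Complex.I) * H (p, y.2)

theorem norm_exp_phase (c p s : ℝ) : ‖Complex.exp (c * p * s * Complex.I)‖ = 1 := by
  exact_mod_cast Complex.norm_exp_ofReal_mul_I (c * p * s)

theorem HasPartials.comp_slice {H H₁ H₂ : ℝ × ℝ → ℂ} (h : HasPartials H H₁ H₂) (p : ℝ) :
    HasPartials (fun y => H (p, y.2)) (fun _ => 0) (fun y => H₂ (p, y.2)) := by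
  intro y
  have h₁ : HasFDerivAt (fun y : ℝ × ℝ => (p, y.2))
      ((0 : ℝ × ℝ →L[ℝ] ℝ).prod (ContinuousLinearMap.snd ℝ ℝ ℝ)) y :=
    (hasFDerivAt_const p y).prodMk hasFDerivAt_snd
  exact ((h (p, y.2)).comp y h₁).congr_fderiv (by ext <;> simp)

namespace CylSchwartz

variable {H : ℝ × ℝ → ℂ}

theorem integrable_phase_mul (h : CylSchwartz H) (c : ℝ) (y : ℝ × ℝ) :
    Integrable fun p : ℝ => Complex.exp (c * p * y.1 * Complex.I) * H (p, y.2) := by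
  refine (h.integrable y.2).bdd_mul (c := 1) ?_ (.of_forall fun p => (norm_exp_phase c p _).le)
  exact Continuous.aestronglyMeasurable (by fun_prop)

theorem norm_oscTransform_le (h : CylSchwartz H) (c : ℝ) :
    ∃ C : ℝ, ∀ y : ℝ × ℝ, ‖oscTransform c H y‖ ≤ C := by
  obtain ⟨C, -, hC⟩ := h.exists_integrable_bound
  refine ⟨∫ p : ℝ, C * (1 + p ^ 2)⁻¹, fun y => ?_⟩
  refine norm_integral_le_of_norm_le (integrable_inv_one_add_sq.const_mul C) (.of_forall fun p => ?_)
  rw [norm_mul, norm_exp_phase, one_mul]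
  exact hC (p, y.2)

theorem hasPartials_oscTransform (h : CylSchwartz H) (c : ℝ) :
    HasPartials (oscTransform c H)
      (oscTransform c fun y => Complex.I * c * (y.1 * H y)) (oscTransform c (_root_.partialSnd H)) := by
  intro y₀
  have hA : CylSchwartz fun y => Complex.I * c * (y.1 * H y) := h.fst_mul.const_mul _
  have hB := h.partialSnd
  obtain ⟨A, hA₀, hA'⟩ := hA.exists_integrable_bound
  obtain ⟨B, hB₀, hB'⟩ := hB.exists_integrable_bound
  set L₁ := Complex.ofRealCLM.comp (ContinuousLinearMap.fst ℝ ℝ ℝ)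
  set L₂ := Complex.ofRealCLM.comp (ContinuousLinearMap.snd ℝ ℝ ℝ)
  have key := hasFDerivAt_integral_of_dominated_of_fderiv_le (μ := volume) (𝕜 := ℝ) (x₀ := y₀)
    (F := fun y (p : ℝ) => Complex.exp (c * p * y.1 * Complex.I) * H (p, y.2))
    (F' := fun y (p : ℝ) =>
      (Complex.exp (c * p * y.1 * Complex.I) * (Complex.I * c * (p * H (p, y.2)))) • L₁ +
      (Complex.exp (c * p * y.1 * Complex.I) * _root_.partialSnd H (p, y.2)) • L₂)
    (bound := fun p => A * (1 + p ^ 2)⁻¹ * ‖L₁‖ + B * (1 + p ^ 2)⁻¹ * ‖L₂‖)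
    Filter.univ_mem (.of_forall fun y => (h.integrable_phase_mul c y).aestronglyMeasurable)
    (h.integrable_phase_mul c y₀)
    (((hA.integrable_phase_mul c y₀).smul_const L₁).add
      ((hB.integrable_phase_mul c y₀).smul_const L₂)).aestronglyMeasurable
    (.of_forall fun p y _ => ?_)
    (((integrable_inv_one_add_sq.const_mul A).mul_const _).add
      ((integrable_inv_one_add_sq.const_mul B).mul_const _))
    (.of_forall fun p y _ => ?_)
  · refine key.congr_fderiv ?_
    rw [integral_add ((hA.integrable_phase_mul c y₀).smul_const L₁)
      ((hB.integrable_phase_mul c y₀).smul_const L₂), integral_smul_const, integral_smul_const]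
    rfl
  · refine (norm_add_le _ _).trans (add_le_add ?_ ?_) <;>
      rw [norm_smul, norm_mul, norm_exp_phase, one_mul] <;>
      refine mul_le_mul_of_nonneg_right ?_ (norm_nonneg _)
    exacts [hA' (p, y.2), hB' (p, y.2)]
  · have h₁ : HasPartials (fun y : ℝ × ℝ => (c * p * y.1 * Complex.I : ℂ))
        (fun _ => c * p * Complex.I) (fun _ => 0) := by
      simpa using ((hasPartials_const (c * p)).mul hasPartials_fst).mul
        (hasPartials_const Complex.I)
    refine ((h₁.cexp.mul (h.hasPartials.comp_slice p)) y).congr_fderiv ?_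
    congr 2
    · ring
    · ring

/-- Integration by parts: multiplication by `s` becomes differentiation in `p`. -/
theorem fst_mul_oscTransform (h : CylSchwartz H) {c : ℝ} (hc : c ≠ 0) (y : ℝ × ℝ) :
    y.1 * oscTransform c H y = Complex.I / c * oscTransform c (_root_.partialFst H) y := by
  have hc' : (c : ℂ) ≠ 0 := by exact_mod_cast hc
  have hu : ∀ p : ℝ, HasDerivAt (fun p : ℝ => Complex.exp (c * p * y.1 * Complex.I))
      (Complex.exp (c * p * y.1 * Complex.I) * (c * y.1 * Complex.I)) p := by
    intro p
    have : HasDerivAt (fun p : ℝ => (c * p * y.1 * Complex.I : ℂ)) (c * y.1 * Complex.I) p := by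
      simpa using (((Complex.ofRealCLM.hasDerivAt (x := p)).const_mul (c : ℂ)).mul_const
        (y.1 : ℂ)).mul_const Complex.I
    exact this.cexp
  have hv : ∀ p : ℝ, HasDerivAt (fun p : ℝ => H (p, y.2)) (_root_.partialFst H (p, y.2)) p := by
    intro p
    have h₁ : HasDerivAt (fun p : ℝ => (p, y.2)) (1, 0) p :=
      (hasDerivAt_id p).prodMk (hasDerivAt_const p y.2)
    exact ((h.differentiable (p, y.2)).hasFDerivAt.comp_hasDerivAt p h₁)
  have hi := h.integrable_phase_mul c y
  have := integral_mul_deriv_eq_deriv_mul_of_integrable (fun p _ => hu p) (fun p _ => hv p)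
    (h.partialFst.integrable_phase_mul c y)
    ((hi.const_mul (c * y.1 * Complex.I)).congr
      (.of_forall fun p => by simp only [Pi.mul_apply]; ring)) hi
  simp only [oscTransform]
  rw [this, ← integral_const_mul, ← integral_neg, ← integral_const_mul]
  refine integral_congr_ae (.of_forall fun p => ?_)
  have hI : Complex.I * Complex.I = -1 := Complex.I_mul_I
  simp only
  rw [div_mul_eq_mul_div, eq_div_iff hc']
  linear_combination (c * Complex.exp (c * p * y.1 * Complex.I) * (y.1 : ℂ) * H (p, y.2)) * hI

theorem oscTransform_decay (h : CylSchwartz H) {c : ℝ} (hc : c ≠ 0) (a : ℕ) :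
    ∃ C : ℝ, ∀ y : ℝ × ℝ, |y.1| ^ a * ‖oscTransform c H y‖ ≤ C := by
  induction a generalizing H with
  | zero => simpa using h.norm_oscTransform_le c
  | succ a ih =>
    obtain ⟨C, hC⟩ := ih h.partialFst
    refine ⟨‖Complex.I / c‖ * C, fun y => ?_⟩
    have : |y.1| ^ (a + 1) * ‖oscTransform c H y‖ =
        |y.1| ^ a * ‖(y.1 : ℂ) * oscTransform c H y‖ := by
      simp [pow_succ]; ring
    rw [this, h.fst_mul_oscTransform hc, norm_mul, mul_left_comm]
    exact mul_le_mul_of_nonneg_left (hC y) (norm_nonneg _)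

/-- The Fourier transform in `p` preserves the Schwartz class of the cylinder. -/
theorem oscTransform (h : CylSchwartz H) {c : ℝ} (hc : c ≠ 0) : CylSchwartz (oscTransform c H) := by
  refine CylSpan.cylSchwartz (Y := fun G => ∃ H, CylSchwartz H ∧ G = _root_.oscTransform c H)
    ?_ ?_ (.base ⟨H, h, rfl⟩)
  · rintro _ ⟨H, h, rfl⟩
    exact ⟨_, _, .base ⟨_, h.fst_mul.const_mul _, rfl⟩, .base ⟨_, h.partialSnd, rfl⟩,
      h.hasPartials_oscTransform c⟩
  · rintro _ ⟨H, h, rfl⟩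
    exact h.oscTransform_decay hc

end CylSchwartz

/-! ### Restriction of planar functions to the cylinder -/

/-- The point `i s e^{iθ}` of the plane with polar coordinates `(s, θ)`; `s` may be negative. -/
noncomputable def polarPoint (y : ℝ × ℝ) : ℂ := Complex.I * y.1 * unitDir y

theorem norm_polarPoint (y : ℝ × ℝ) : ‖polarPoint y‖ = |y.1| := by
  simp [polarPoint, norm_unitDir]

/-- A real-linear form on `ℂ` as a combination of `dz` and `dz̄`. -/
theorem clm_apply_eq_wirtinger (L : ℂ →L[ℝ] ℂ) (v : ℂ) :
    L v = v * ((L 1 - Complex.I * L Complex.I) / 2) +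
      conj v * ((L 1 + Complex.I * L Complex.I) / 2) := by
  have h : L v = v.re * L 1 + v.im * L Complex.I := by
    conv_lhs => rw [show v = v.re • (1 : ℂ) + v.im • Complex.I by
      simp [Complex.re_add_im]]
    rw [map_add, map_smul, map_smul]
    simp
  have h₁ : v = v.re + v.im * Complex.I := (Complex.re_add_im v).symm
  have h₂ : conj v = v.re - v.im * Complex.I := by
    apply Complex.ext <;> simp
  rw [h, h₂]
  nth_rw 3 [h₁]
  linear_combination (v.im : ℂ) * L Complex.I * Complex.I_mul_I

theorem hasPartials_comp_polarPoint {b : ℂ → ℂ} (hb : Differentiable ℝ b) :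
    HasPartials (fun y => b (polarPoint y))
      (fun y => fderiv ℝ b (polarPoint y) (Complex.I * unitDir y))
      (fun y => fderiv ℝ b (polarPoint y) (-(y.1 * unitDir y))) := by
  intro y
  have h : HasPartials polarPoint (fun y => Complex.I * unitDir y)
      (fun y => -(y.1 * unitDir y)) := by
    have h := ((hasPartials_const Complex.I).mul hasPartials_fst).mul hasPartials_unitDir
    have e : (fun y : ℝ × ℝ => (0 * (y.1 : ℂ) + Complex.I * 0) * unitDir y +
        Complex.I * y.1 * (Complex.I * unitDir y)) = fun y => -(y.1 * unitDir y) := by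
      funext y
      linear_combination (y.1 : ℂ) * unitDir y * Complex.I_mul_I
    rw [e] at h
    simpa [show polarPoint = fun y : ℝ × ℝ => Complex.I * y.1 * unitDir y from rfl] using h
  refine ((hb (polarPoint y)).hasFDerivAt.comp y (h y)).congr_fderiv ?_
  ext <;> simp

open LineDeriv in
theorem SchwartzMap.fderiv_eq_wirtinger (b : 𝓢(ℂ, ℂ)) : ∃ b₁ b₂ : 𝓢(ℂ, ℂ),
    ∀ w v : ℂ, fderiv ℝ b w v = v * b₁ w + conj v * b₂ w := by
  refine ⟨(1 / 2 : ℂ) • (∂_{(1 : ℂ)} b - Complex.I • ∂_{Complex.I} b),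
    (1 / 2 : ℂ) • (∂_{(1 : ℂ)} b + Complex.I • ∂_{Complex.I} b), fun w v => ?_⟩
  rw [clm_apply_eq_wirtinger]
  simp [SchwartzMap.lineDerivOp_apply_eq_fderiv]
  ring

theorem SchwartzMap.cylSchwartz_comp_polarPoint (b : 𝓢(ℂ, ℂ)) :
    CylSchwartz fun y => b (polarPoint y) := by
  refine CylSpan.cylSchwartz (Y := fun G => ∃ b : 𝓢(ℂ, ℂ), G = fun y => b (polarPoint y))
    ?_ ?_ (.base ⟨b, rfl⟩)
  · rintro _ ⟨b, rfl⟩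
    obtain ⟨b₁, b₂, hb⟩ := b.fderiv_eq_wirtinger
    have k₁ := CylSpan.base (Y := fun G => ∃ b : 𝓢(ℂ, ℂ), G = fun y => b (polarPoint y)) ⟨b₁, rfl⟩
    have k₂ := CylSpan.base (Y := fun G => ∃ b : 𝓢(ℂ, ℂ), G = fun y => b (polarPoint y)) ⟨b₂, rfl⟩
    refine ⟨_, _, (k₁.dir_mul.const_mul Complex.I).add (k₂.conj_mul.const_mul (-Complex.I)),
      (k₁.dir_mul.fst_mul.const_mul (-1)).add (k₂.conj_mul.fst_mul.const_mul (-1)), ?_⟩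
    convert hasPartials_comp_polarPoint b.differentiable using 2 <;>
      · simp [hb]; ring
  · rintro _ ⟨b, rfl⟩ a
    obtain ⟨C, hC⟩ := b.decay' a 0
    refine ⟨C, fun y => ?_⟩
    have := hC (polarPoint y)
    rwa [norm_iteratedFDeriv_zero, norm_polarPoint] at this

/-! ### The ray transform of functions -/

/-- The integral of `a` along the line of `T𝕊¹` with coordinates `(p, θ)`. -/
noncomputable def rayTransform (a : ℂ → ℂ) (y : ℝ × ℝ) : ℂ :=
  ∫ t : ℝ, a (polarPoint y + t * unitDir y)

/-- The plane is swept isometrically by the lines of a fixed direction. -/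
theorem measurePreserving_lines (θ : ℝ) : ∃ e : ℝ × ℝ ≃ᵐ ℂ, MeasurePreserving e volume volume ∧
    ∀ t p : ℝ, e (t, p) = polarPoint (p, θ) + t * unitDir (p, θ) := by
  have h₁ := (rotation (Circle.exp θ)).measurePreserving
  refine ⟨Complex.measurableEquivRealProd.symm.trans
    (rotation (Circle.exp θ)).toHomeomorph.toMeasurableEquiv,
    Complex.volume_preserving_equiv_real_prod.symm.trans h₁, fun t p => ?_⟩
  have h₂ : Complex.measurableEquivRealProd.symm (t, p) = t + p * Complex.I := by
    apply Complex.ext <;> simp [Complex.measurableEquivRealProd_symm_apply]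
  simp only [MeasurableEquiv.trans_apply, h₂]
  simp [polarPoint, unitDir, Circle.coe_exp]
  ring

/-- The coordinate `p` of the line with direction `ζ` through the point `w` is `Im (w ζ̄)`. -/
theorem im_line_mul_conj (θ t p : ℝ) :
    ((polarPoint (p, θ) + t * unitDir (p, θ)) * conj (unitDir (0, θ))).im = p := by
  have h : unitDir (p, θ) * conj (unitDir (0, θ)) = 1 := unitDir_mul_conj (p, θ)
  rw [show (polarPoint (p, θ) + t * unitDir (p, θ)) * conj (unitDir (0, θ)) =
    (Complex.I * p + t) * (unitDir (p, θ) * conj (unitDir (0, θ))) by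
      simp only [polarPoint]; ring, h]
  simp

/-- Fubini's theorem for the lines of direction `e^{iθ}`. -/
theorem integral_mul_rayTransform (θ : ℝ) (h : ℝ → ℂ) (a : ℂ → ℂ)
    (hi : Integrable fun w => h (w * conj (unitDir (0, θ))).im * a w) :
    (Integrable fun p : ℝ => h p * rayTransform a (p, θ)) ∧
      ∫ p : ℝ, h p * rayTransform a (p, θ) = ∫ w, h (w * conj (unitDir (0, θ))).im * a w := by
  obtain ⟨e, he, hf⟩ := measurePreserving_lines θ
  have hi' := (he.integrable_comp_emb e.measurableEmbedding).2 hi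
  have key : ∀ p : ℝ, h p * rayTransform a (p, θ) = ∫ t : ℝ,
      ((fun w => h (w * conj (unitDir (0, θ))).im * a w) ∘ e) (t, p) := by
    intro p
    simp only [rayTransform, Function.comp, hf, im_line_mul_conj, integral_const_mul]
  simp only [key]
  refine ⟨hi'.integral_prod_right, ?_⟩
  rw [← he.integral_comp e.measurableEmbedding]
  exact (integral_prod_symm _ hi').symm

theorem norm_line_sq (y : ℝ × ℝ) (t : ℝ) :
    ‖polarPoint y + t * unitDir y‖ ^ 2 = t ^ 2 + y.1 ^ 2 := by
  rw [show polarPoint y + t * unitDir y = (t + y.1 * Complex.I) * unitDir y by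
    simp only [polarPoint]; ring, norm_mul, norm_unitDir, mul_one, Complex.norm_add_mul_I,
    Real.sq_sqrt (by positivity)]

open FourierTransform in
theorem fourier_fourierInv_eq_of_integrable {f : ℝ → ℂ} (hc : Continuous f) (hi : Integrable f)
    (hinv : Integrable (𝓕⁻ f)) : 𝓕 (𝓕⁻ f) = f := by
  refine hc.fourier_fourierInv_eq hi (hinv.comp_neg.congr (.of_forall fun s => ?_))
  simp only
  rw [Real.fourierInv_eq_fourier_neg, neg_neg]

namespace SchwartzMap

theorem exists_bound_line (a : 𝓢(ℂ, ℂ)) : ∃ C : ℝ, ∀ (y : ℝ × ℝ) (t : ℝ),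
    ‖a (polarPoint y + t * unitDir y)‖ ≤ C * (1 + t ^ 2)⁻¹ := by
  obtain ⟨C₀, h₀⟩ := a.decay 0 0
  obtain ⟨C₂, h₂⟩ := a.decay 2 0
  refine ⟨C₀ + C₂, fun y t => ?_⟩
  rw [← div_eq_mul_inv, le_div_iff₀ (by positivity)]
  have k₀ := h₀.2 (polarPoint y + t * unitDir y)
  have k₂ := h₂.2 (polarPoint y + t * unitDir y)
  rw [norm_iteratedFDeriv_zero] at k₀ k₂
  rw [norm_line_sq] at k₂
  have := norm_nonneg (a (polarPoint y + t * unitDir y))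
  nlinarith [mul_nonneg (sq_nonneg y.1) this]

theorem continuous_unitDir : Continuous unitDir := by
  unfold unitDir; fun_prop

theorem continuous_line (t : ℝ) : Continuous fun y => polarPoint y + t * unitDir y := by
  have := continuous_unitDir
  unfold polarPoint
  fun_prop

theorem integrable_line (a : 𝓢(ℂ, ℂ)) (y : ℝ × ℝ) :
    Integrable fun t : ℝ => a (polarPoint y + t * unitDir y) := by
  obtain ⟨C, hC⟩ := a.exists_bound_line
  refine (integrable_inv_one_add_sq.const_mul C).mono' ?_ (.of_forall fun t => hC y t)
  exact (a.continuous.comp (by fun_prop)).aestronglyMeasurable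

theorem continuous_rayTransform (a : 𝓢(ℂ, ℂ)) : Continuous (rayTransform a) := by
  obtain ⟨C, hC⟩ := a.exists_bound_line
  exact continuous_of_dominated (fun y => (a.integrable_line y).aestronglyMeasurable)
    (fun y => .of_forall fun t => hC y t) (integrable_inv_one_add_sq.const_mul C)
    (.of_forall fun t => a.continuous.comp (continuous_line t))

open FourierTransform in
/-- The central slice theorem: the ray transform of the Fourier transform of `A` is the
one-dimensional Fourier transform of the restriction of `A` to a line through the origin. -/
theorem rayTransform_fourier (A : 𝓢(ℂ, ℂ)) :
    rayTransform (𝓕 A : 𝓢(ℂ, ℂ)) = oscTransform (-(2 * Real.pi)) fun y => A (polarPoint y) := by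
  obtain ⟨B, hB⟩ : ∃ B : 𝓢(ℂ, ℂ), B = 𝓕 A := ⟨_, rfl⟩
  rw [← hB]
  funext ⟨p, θ⟩
  have hinv : 𝓕⁻ (fun p : ℝ => rayTransform B (p, θ)) =
      fun s : ℝ => A (polarPoint (s, θ)) := by
    funext s
    have hb : ∀ r : ℝ, ‖Complex.exp ((2 * Real.pi * (r * s) : ℝ) * Complex.I)‖ = 1 := fun r =>
      Complex.norm_exp_ofReal_mul_I _
    have hi : Integrable fun w : ℂ => Complex.exp
        ((2 * Real.pi * ((w * conj (unitDir (0, θ))).im * s) : ℝ) * Complex.I) * B w := by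
      refine B.integrable.bdd_mul (c := 1) ?_ (.of_forall fun w => (hb _).le)
      exact Continuous.aestronglyMeasurable (by fun_prop)
    rw [Real.fourierInv_eq']
    simp only [smul_eq_mul, RCLike.inner_apply, conj_trivial]
    have := (integral_mul_rayTransform θ
      (fun r => Complex.exp ((2 * Real.pi * (r * s) : ℝ) * Complex.I)) B hi).2
    have hA : A (polarPoint (s, θ)) = ((𝓕⁻ B : 𝓢(ℂ, ℂ))) (polarPoint (s, θ)) := by
      rw [hB, FourierTransform.fourierInv_fourier_eq]
    rw [hA, SchwartzMap.fourierInv_coe, Real.fourierInv_eq']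
    simp only [mul_comm s] at this ⊢
    rw [this]
    refine integral_congr_ae (.of_forall fun w => ?_)
    simp only [smul_eq_mul]
    congr 5
    rw [Complex.inner]
    simp [polarPoint, unitDir]
    ring
  have hi : Integrable fun p : ℝ => rayTransform B (p, θ) := by
    simpa using (integral_mul_rayTransform θ (fun _ => 1) B
      (by simpa using B.integrable)).1
  have hc : Continuous fun p : ℝ => rayTransform B (p, θ) :=
    B.continuous_rayTransform.comp (by fun_prop)
  have := fourier_fourierInv_eq_of_integrable hc hi (by
    rw [hinv]; exact A.cylSchwartz_comp_polarPoint.integrable θ)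
  rw [← congrFun this p, hinv, Real.fourier_eq']
  refine integral_congr_ae (.of_forall fun s => ?_)
  simp only [smul_eq_mul, RCLike.inner_apply, conj_trivial]
  congr 2
  push_cast
  ring

open FourierTransform in
/-- By the central slice theorem, since restriction to the cylinder and the Fourier transform in `p`
both preserve the Schwartz classes. -/
theorem cylSchwartz_rayTransform (a : 𝓢(ℂ, ℂ)) : CylSchwartz (rayTransform a) := by
  have h := (𝓕⁻ a : 𝓢(ℂ, ℂ)).rayTransform_fourier
  rw [FourierTransform.fourier_fourierInv_eq] at h
  rw [h]
  exact (𝓕⁻ a : 𝓢(ℂ, ℂ)).cylSchwartz_comp_polarPoint.oscTransform (by simp [Real.pi_ne_zero])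

/-- The moment conditions for the ray transform of a function. -/
theorem exists_moment_polynomial (a : 𝓢(ℂ, ℂ)) (r : ℕ) :
    ∃ P : MvPolynomial (Fin 2) ℂ, P.IsHomogeneous r ∧ ∀ θ : ℝ,
      ∫ p : ℝ, (p : ℂ) ^ r * rayTransform a (p, θ) =
        MvPolynomial.eval ![unitDir (0, θ), conj (unitDir (0, θ))] P := by
  have hint : ∀ j ∈ Finset.range (r + 1),
      Integrable fun w : ℂ => w ^ j * conj w ^ (r - j) * a w := by
    intro j hj
    refine ((a.integrable_pow_mul volume r).congr' ?_ (.of_forall fun w => ?_))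
    · exact Continuous.aestronglyMeasurable (by fun_prop)
    · have : j + (r - j) = r := by simp at hj; omega
      simp [← pow_add, this]
  refine ⟨∑ j ∈ Finset.range (r + 1), MvPolynomial.C ((2 * Complex.I)⁻¹ ^ r *
      (-1) ^ (r - j) * r.choose j * ∫ w : ℂ, w ^ j * conj w ^ (r - j) * a w) *
      (MvPolynomial.X 0 ^ (r - j) * MvPolynomial.X 1 ^ j), ?_, fun θ => ?_⟩
  · refine MvPolynomial.IsHomogeneous.sum _ _ _ fun j hj => ?_
    have : (0 : ℕ) + ((r - j) + j) = r := by simp at hj; omega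
    have h := (MvPolynomial.isHomogeneous_C (Fin 2) ((2 * Complex.I)⁻¹ ^ r *
      (-1) ^ (r - j) * r.choose j * ∫ w : ℂ, w ^ j * conj w ^ (r - j) * a w)).mul
      (((MvPolynomial.isHomogeneous_X ℂ (0 : Fin 2)).pow (r - j)).mul
        ((MvPolynomial.isHomogeneous_X ℂ (1 : Fin 2)).pow j))
    simpa only [one_mul, this] using h
  · set u := unitDir (0, θ)
    have hexp : ∀ w : ℂ, ((w * conj u).im : ℂ) ^ r * a w = ∑ j ∈ Finset.range (r + 1),
        ((2 * Complex.I)⁻¹ ^ r * (-1) ^ (r - j) * r.choose j * (u ^ (r - j) * conj u ^ j)) *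
          (w ^ j * conj w ^ (r - j) * a w) := by
      intro w
      have him : ((w * conj u).im : ℂ) = (2 * Complex.I)⁻¹ * (w * conj u + -1 * (conj w * u)) := by
        rw [Complex.im_eq_sub_conj]
        have hI : Complex.I ≠ 0 := Complex.I_ne_zero
        simp only [map_mul, Complex.conj_conj]
        field_simp
        ring
      rw [him, mul_pow, add_pow, Finset.mul_sum, Finset.sum_mul]
      refine Finset.sum_congr rfl fun j _ => ?_
      simp only [mul_pow]
      ring
    have hi : Integrable fun w : ℂ => ((w * conj u).im : ℂ) ^ r * a w := by
      simp only [hexp]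
      exact integrable_finsetSum _ fun j hj => (hint j hj).const_mul _
    refine (integral_mul_rayTransform θ (fun p => (p : ℂ) ^ r) a hi).2.trans ?_
    change ∫ w, ((w * conj u).im : ℂ) ^ r * a w = _
    simp only [hexp]
    rw [integral_finsetSum _ fun j hj => (hint j hj).const_mul _]
    simp only [integral_const_mul, map_sum, map_mul, map_pow, MvPolynomial.eval_C,
      MvPolynomial.eval_X]
    refine Finset.sum_congr rfl fun j _ => ?_
    change _ = _ * (u ^ (r - j) * conj u ^ j)
    ring

end SchwartzMap

/-! ### Flat functions on the cylinder and smooth functions on the plane -/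

theorem contDiff_partialFst {G : ℝ × ℝ → ℂ} (h : ContDiff ℝ ∞ G) : ContDiff ℝ ∞ (partialFst G) :=
  (h.fderiv_right (by simp)).clm_apply contDiff_const

theorem contDiff_partialSnd {G : ℝ × ℝ → ℂ} (h : ContDiff ℝ ∞ G) : ContDiff ℝ ∞ (partialSnd G) :=
  (h.fderiv_right (by simp)).clm_apply contDiff_const

theorem contDiff_iterate_partialFst {G : ℝ × ℝ → ℂ} (h : ContDiff ℝ ∞ G) (j : ℕ) :
    ContDiff ℝ ∞ (partialFst^[j] G) := by
  induction j generalizing G with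
  | zero => exact h
  | succ j ih => exact ih (contDiff_partialFst h)

theorem hasPartials_of_contDiff {G : ℝ × ℝ → ℂ} (h : ContDiff ℝ ∞ G) :
    HasPartials G (partialFst G) (partialSnd G) :=
  hasPartials_of_differentiable (h.differentiable (by simp))

theorem iterate_partialFst_add {G H : ℝ × ℝ → ℂ} (hG : ContDiff ℝ ∞ G) (hH : ContDiff ℝ ∞ H)
    (j : ℕ) : partialFst^[j] (fun y => G y + H y) =
      fun y => partialFst^[j] G y + partialFst^[j] H y := by
  induction j generalizing G H with
  | zero => rfl
  | succ j ih =>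
    simp only [Function.iterate_succ_apply]
    rw [((hasPartials_of_contDiff hG).add (hasPartials_of_contDiff hH)).eq.1]
    exact ih (contDiff_partialFst hG) (contDiff_partialFst hH)

theorem iterate_partialFst_partialSnd {G : ℝ × ℝ → ℂ} (hG : ContDiff ℝ ∞ G) (j : ℕ) :
    partialFst^[j] (partialSnd G) = partialSnd (partialFst^[j] G) := by
  induction j generalizing G with
  | zero => rfl
  | succ j ih =>
    simp only [Function.iterate_succ_apply]
    rw [← ih (contDiff_partialFst hG)]
    congr 1
    funext y
    have hs : IsSymmSndFDerivAt ℝ G y := hG.contDiffAt.isSymmSndFDerivAt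
      (by
      rw [minSmoothness_of_isRCLikeNormedField]
      exact WithTop.coe_le_coe.2 (le_top : (2 : ℕ∞) ≤ ⊤))
    have hd : DifferentiableAt ℝ (fderiv ℝ G) y :=
      ((hG.fderiv_right (m := ∞) (by simp)).differentiable (by simp)) y
    change fderiv ℝ (fun z => fderiv ℝ G z (0, 1)) y (1, 0) =
      fderiv ℝ (fun z => fderiv ℝ G z (1, 0)) y (0, 1)
    rw [fderiv_clm_apply hd (by fun_prop), fderiv_clm_apply hd (by fun_prop)]
    simpa using hs (1, 0) (0, 1)

/-- `G` is smooth and vanishes to infinite order along the circle `s = 0`. -/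
def Flat (G : ℝ × ℝ → ℂ) : Prop :=
  ContDiff ℝ ∞ G ∧ ∀ (j : ℕ) (θ : ℝ), partialFst^[j] G (0, θ) = 0

namespace Flat

variable {G H : ℝ × ℝ → ℂ}

theorem add (hG : Flat G) (hH : Flat H) : Flat fun y => G y + H y :=
  ⟨hG.1.add hH.1, fun j θ => by
    rw [iterate_partialFst_add hG.1 hH.1]; simp [hG.2 j θ, hH.2 j θ]⟩

theorem partialFst (hG : Flat G) : Flat (partialFst G) :=
  ⟨contDiff_partialFst hG.1, fun j θ => hG.2 (j + 1) θ⟩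

theorem partialSnd (hG : Flat G) : Flat (partialSnd G) := by
  refine ⟨contDiff_partialSnd hG.1, fun j θ => ?_⟩
  rw [iterate_partialFst_partialSnd hG.1]
  -- The function vanishes along `s = 0`, so its derivative in `θ` does as well.
  have h := contDiff_iterate_partialFst hG.1 j
  have hl : HasDerivAt (fun θ : ℝ => ((0 : ℝ), θ)) (0, 1) θ :=
    (hasDerivAt_const θ (0 : ℝ)).prodMk (hasDerivAt_id θ)
  have hd := ((h.differentiable (by simp)) (0, θ)).hasFDerivAt.comp_hasDerivAt θ hl
  have hz : (_root_.partialFst^[j] G) ∘ (fun θ : ℝ => ((0 : ℝ), θ)) = fun _ => 0 :=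
    funext fun θ => hG.2 j θ
  rw [hz] at hd
  exact hd.unique (hasDerivAt_const θ 0)

theorem mul_left {u : ℝ × ℝ → ℂ} (hu : ContDiff ℝ ∞ u) (hG : Flat G) : Flat fun y => u y * G y := by
  refine ⟨hu.mul hG.1, fun j θ => ?_⟩
  induction j generalizing u G with
  | zero => simp [show G (0, θ) = 0 from hG.2 0 θ]
  | succ j ih =>
    rw [Function.iterate_succ_apply,
      ((hasPartials_of_contDiff hu).mul (hasPartials_of_contDiff hG.1)).eq.1,
      iterate_partialFst_add ((contDiff_partialFst hu).mul hG.1) (hu.mul hG.partialFst.1)]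
    simp only [ih (contDiff_partialFst hu) hG, ih hu hG.partialFst, add_zero]

/-- A flat Schwartz function is bounded by every power of `|s|`. -/
theorem exists_bound_pow (hG : Flat G) (h : CylSchwartz G) (m : ℕ) :
    ∃ C : ℝ, 0 ≤ C ∧ ∀ y : ℝ × ℝ, ‖G y‖ ≤ C * |y.1| ^ m := by
  induction m generalizing G with
  | zero =>
    obtain ⟨C, hC⟩ := h.decay 0
    have hC' : ∀ y, ‖G y‖ ≤ C := by simpa using hC
    exact ⟨C, (norm_nonneg _).trans (hC' 0), fun y => by simpa using hC' y⟩
  | succ m ih =>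
    obtain ⟨C, hC₀, hC⟩ := ih hG.partialFst h.partialFst
    refine ⟨C, hC₀, fun ⟨s, θ⟩ => ?_⟩
    have hd : ∀ x ∈ Metric.closedBall (0 : ℝ) |s|, HasDerivWithinAt (fun x => G (x, θ))
        (_root_.partialFst G (x, θ)) (Metric.closedBall (0 : ℝ) |s|) x := by
      intro x _
      have hl : HasDerivAt (fun x : ℝ => (x, θ)) (1, 0) x :=
        (hasDerivAt_id x).prodMk (hasDerivAt_const x θ)
      exact ((h.differentiable (x, θ)).hasFDerivAt.comp_hasDerivAt x hl).hasDerivWithinAt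
    have hb : ∀ x ∈ Metric.closedBall (0 : ℝ) |s|, ‖_root_.partialFst G (x, θ)‖ ≤ C * |s| ^ m := by
      intro x hx
      have hx' : |x| ≤ |s| := by simpa using hx
      exact (hC (x, θ)).trans (by gcongr)
    have := (convex_closedBall (0 : ℝ) |s|).norm_image_sub_le_of_norm_hasDerivWithin_le hd hb
      (x := 0) (y := s) (by simp) (by simp)
    simpa [show G (0, θ) = 0 from hG.2 0 θ, pow_succ, mul_assoc] using this

theorem exists_bound_inv_pow (hG : Flat G) (h : CylSchwartz G) (a k : ℕ) :
    ∃ C : ℝ, ∀ y : ℝ × ℝ, |y.1| ^ a * ‖((y.1 : ℂ) ^ k)⁻¹ * G y‖ ≤ C := by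
  obtain ⟨C, hC₀, hC⟩ := hG.exists_bound_pow h k
  obtain ⟨D, hD⟩ := h.decay a
  refine ⟨max C D, fun y => ?_⟩
  simp only [norm_mul, norm_inv, norm_pow, Complex.norm_real, Real.norm_eq_abs]
  rcases le_total |y.1| 1 with h₁ | h₁
  · refine le_max_of_le_left ?_
    calc |y.1| ^ a * ((|y.1| ^ k)⁻¹ * ‖G y‖) ≤ 1 * ((|y.1| ^ k)⁻¹ * (C * |y.1| ^ k)) := by
          gcongr
          · exact pow_le_one₀ (abs_nonneg _) h₁
          · exact hC y
      _ = C * ((|y.1| ^ k)⁻¹ * |y.1| ^ k) := by ring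
      _ ≤ C * 1 := by gcongr; exact inv_mul_le_one
      _ = C := mul_one C
  · refine le_max_of_le_right (le_trans ?_ (hD y))
    gcongr
    exact mul_le_of_le_one_left (norm_nonneg _) (inv_le_one_of_one_le₀ (one_le_pow₀ h₁))

end Flat

/-- The polar coordinates of a point with `s ≥ 0`. -/
noncomputable def polarCoords (w : ℂ) : ℝ × ℝ := (‖w‖, w.arg - Real.pi / 2)

theorem polarPoint_polarCoords (w : ℂ) : polarPoint (polarCoords w) = w := by
  have h : Complex.exp (-(Real.pi / 2 * Complex.I)) = -Complex.I := by
    rw [← neg_mul, ← neg_div, Complex.exp_neg_pi_div_two_mul_I]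
  have : unitDir (polarCoords w) = Complex.exp (w.arg * Complex.I) * -Complex.I := by
    rw [← h, ← Complex.exp_add, unitDir, polarCoords]
    congr 1
    push_cast
    ring
  rw [polarPoint, this, polarCoords]
  conv_rhs => rw [← Complex.norm_mul_exp_arg_mul_I w]
  linear_combination (-(‖w‖ : ℂ) * Complex.exp (w.arg * Complex.I)) * Complex.I_mul_I

theorem fst_polarCoords (w : ℂ) : (polarCoords w).1 = ‖w‖ := rfl

theorem wirtinger_coeff_unique {a b a' b' : ℂ}
    (h : ∀ v : ℂ, v * a + conj v * b = v * a' + conj v * b') : a = a' ∧ b = b' := by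
  have h₁ := h 1
  have h₂ := h Complex.I
  simp only [map_one, one_mul, Complex.conj_I] at h₁ h₂
  have h₃ : a - b = a' - b' := mul_left_cancel₀ Complex.I_ne_zero (by linear_combination h₂)
  exact ⟨by linear_combination (h₁ + h₃) / 2, by linear_combination (h₁ - h₃) / 2⟩

/-- Differentiation in polar coordinates, away from the origin: the smooth local inverse of
`polarPoint` is read off from the principal branch of `log (w / w₀)`. -/
theorem hasFDerivAt_of_comp_polarPoint {A : ℂ → ℂ} {Q Q₁ Q₂ : ℝ × ℝ → ℂ}
    (hA : ∀ y, A (polarPoint y) = Q y) {y : ℝ × ℝ} (hy : y.1 ≠ 0)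
    (hQ : HasFDerivAt Q (Q₁ y • Complex.ofRealCLM.comp (ContinuousLinearMap.fst ℝ ℝ ℝ) +
      Q₂ y • Complex.ofRealCLM.comp (ContinuousLinearMap.snd ℝ ℝ ℝ)) y) :
    HasFDerivAt A
      ((conj (unitDir y) * (-Complex.I / 2 * Q₁ y - 1 / 2 * ((y.1 : ℂ)⁻¹ * Q₂ y))) •
        ContinuousLinearMap.id ℝ ℂ +
      (unitDir y * (Complex.I / 2 * Q₁ y - 1 / 2 * ((y.1 : ℂ)⁻¹ * Q₂ y))) •
        (Complex.conjCLE : ℂ →L[ℝ] ℂ)) (polarPoint y) := by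
  have hyc : (y.1 : ℂ) ≠ 0 := by exact_mod_cast hy
  have hu : unitDir y ≠ 0 := Complex.exp_ne_zero _
  set w₀ := polarPoint y with hw₀
  have hw : w₀ ≠ 0 := by simp [hw₀, polarPoint, hy, hu]
  let br : ℂ → ℝ × ℝ := fun w =>
    (y.1 * Real.exp (Complex.log (w₀⁻¹ * w)).re, y.2 + (Complex.log (w₀⁻¹ * w)).im)
  have hbr : ∀ w, w ≠ 0 → polarPoint (br w) = w := by
    intro w hw'
    have h₁ : unitDir (br w) =
        unitDir y * Complex.exp ((Complex.log (w₀⁻¹ * w)).im * Complex.I) := by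
      simp only [unitDir, br, ← Complex.exp_add]
      push_cast; ring_nf
    have h₂ : Complex.exp (Complex.log (w₀⁻¹ * w)).re *
        Complex.exp ((Complex.log (w₀⁻¹ * w)).im * Complex.I) = w₀⁻¹ * w := by
      rw [← Complex.exp_add, Complex.re_add_im, Complex.exp_log (by simp [hw, hw'])]
    calc polarPoint (br w) = w₀ * (Complex.exp (Complex.log (w₀⁻¹ * w)).re *
          Complex.exp ((Complex.log (w₀⁻¹ * w)).im * Complex.I)) := by
          have e : w₀ = Complex.I * y.1 * unitDir y := rfl
          have e' : ((br w).1 : ℂ) = y.1 * Complex.exp (Complex.log (w₀⁻¹ * w)).re := by simp [br]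
          rw [polarPoint, h₁, e']
          linear_combination (-(Complex.exp (Complex.log (w₀⁻¹ * w)).re *
            Complex.exp ((Complex.log (w₀⁻¹ * w)).im * Complex.I))) * e
      _ = w := by rw [h₂, mul_inv_cancel_left₀ hw]
  have hbr₀ : br w₀ = y := by simp [br, inv_mul_cancel₀ hw]
  have hlog : HasFDerivAt (fun w => Complex.log (w₀⁻¹ * w))
      (w₀⁻¹ • ContinuousLinearMap.id ℝ ℂ) w₀ := by
    have h₁ : HasDerivAt (fun w => Complex.log (w₀⁻¹ * w)) w₀⁻¹ w₀ := by
      have h := ((hasDerivAt_id w₀).const_mul w₀⁻¹).clog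
        (by simp [inv_mul_cancel₀ hw, Complex.one_mem_slitPlane])
      simpa [inv_mul_cancel₀ hw] using h
    refine (h₁.hasFDerivAt.restrictScalars ℝ).congr_fderiv ?_
    ext
    simp [mul_comm]
  have hre := Complex.reCLM.hasFDerivAt.comp w₀ hlog
  have him := Complex.imCLM.hasFDerivAt.comp w₀ hlog
  have hd : HasFDerivAt br ((y.1 • Complex.reCLM.comp (w₀⁻¹ • ContinuousLinearMap.id ℝ ℂ)).prod
      (Complex.imCLM.comp (w₀⁻¹ • ContinuousLinearMap.id ℝ ℂ))) w₀ := by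
    refine ((hre.exp.const_mul y.1).prodMk (him.const_add y.2)).congr_fderiv ?_
    simp [inv_mul_cancel₀ hw]
  rw [← hbr₀] at hQ
  have hcomp := hQ.comp w₀ hd
  rw [hbr₀] at hcomp
  have hev : A =ᶠ[nhds w₀] Q ∘ br := by
    filter_upwards [isOpen_ne.mem_nhds hw] with w hw'
    rw [Function.comp, ← hA, hbr w hw']
  refine (hcomp.congr_of_eventuallyEq hev).congr_fderiv ?_
  have hinv : w₀⁻¹ = -Complex.I * (y.1 : ℂ)⁻¹ * conj (unitDir y) := by
    rw [inv_eq_iff_eq_inv, hw₀, polarPoint]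
    refine eq_inv_of_mul_eq_one_left ?_
    have := unitDir_mul_conj y
    field_simp
    linear_combination (-Complex.I ^ 2) * this - Complex.I_sq
  have hreim : ∀ v : ℂ, ((w₀⁻¹ * v).re : ℂ) = (w₀⁻¹ * v + conj (w₀⁻¹ * v)) / 2 ∧
      ((w₀⁻¹ * v).im : ℂ) = (w₀⁻¹ * v - conj (w₀⁻¹ * v)) / (2 * Complex.I) := fun v =>
    ⟨Complex.re_eq_add_conj _, Complex.im_eq_sub_conj _⟩
  refine ContinuousLinearMap.ext fun v => ?_
  simp only [_root_.add_apply, _root_.smul_apply,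
    ContinuousLinearMap.comp_apply, ContinuousLinearMap.prod_apply, ContinuousLinearMap.coe_fst',
    ContinuousLinearMap.coe_snd', ContinuousLinearMap.id_apply, Complex.reCLM_apply,
    Complex.imCLM_apply, smul_eq_mul, Complex.ofRealCLM_apply, Complex.ofReal_mul,
    ContinuousLinearEquiv.coe_coe, Complex.conjCLE_apply]
  rw [(hreim v).1, (hreim v).2, hinv]
  simp only [map_mul, map_neg, Complex.conj_I, Complex.conj_conj, map_inv₀, Complex.conj_ofReal]
  field_simp
  ring_nf

/-- The functions on the plane that equal `s^{-k} G` in polar coordinates `(s, θ)`, with `G` Schwartz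
and flat. This class is closed under differentiation, because `∂_w` and `∂_w̄` are
`∓(i/2) e^{∓iθ} (∂_s ∓ (i/s) ∂_θ)` in these coordinates. -/
def FlatQuotient (A : ℂ → ℂ) : Prop :=
  ∃ (k : ℕ) (G : ℝ × ℝ → ℂ), CylSchwartz G ∧ Flat G ∧
    ∀ y, A (polarPoint y) = ((y.1 : ℂ) ^ k)⁻¹ * G y

theorem contDiff_unitDir : ContDiff ℝ ∞ unitDir := by
  have : ContDiff ℝ ∞ fun y : ℝ × ℝ => (y.2 : ℂ) := Complex.ofRealCLM.contDiff.comp contDiff_snd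
  exact (this.mul contDiff_const).cexp

theorem contDiff_conj_unitDir : ContDiff ℝ ∞ fun y => conj (unitDir y) :=
  Complex.conjCLE.contDiff.comp contDiff_unitDir

theorem contDiff_ofReal_fst : ContDiff ℝ ∞ fun y : ℝ × ℝ => (y.1 : ℂ) :=
  Complex.ofRealCLM.contDiff.comp contDiff_fst

theorem FlatQuotient.bound {A : ℂ → ℂ} (hA : FlatQuotient A) (a : ℕ) :
    ∃ C : ℝ, ∀ w, ‖w‖ ^ a * ‖A w‖ ≤ C := by
  obtain ⟨k, G, hG, hf, h⟩ := hA
  obtain ⟨C, hC⟩ := hf.exists_bound_inv_pow hG a k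
  refine ⟨C, fun w => ?_⟩
  have := hC (polarCoords w)
  rwa [← h, polarPoint_polarCoords, fst_polarCoords, abs_norm] at this

/-- The coefficients of `dw` and `dw̄` in the differential of `A` are given by formulas in polar
coordinates. They are functions on the plane because the differential of `A` at a point is unique,
so no symmetry of `G` has to be tracked. -/
theorem FlatQuotient.hasFDerivAt {A : ℂ → ℂ} (hA : FlatQuotient A) :
    ∃ A₁ A₂, FlatQuotient A₁ ∧ FlatQuotient A₂ ∧ ∀ w, HasFDerivAt A
      (A₁ w • ContinuousLinearMap.id ℝ ℂ + A₂ w • (Complex.conjCLE : ℂ →L[ℝ] ℂ)) w := by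
  obtain ⟨k, G, hG, hf, h⟩ := hA
  -- `s^{k+1}` times the radial derivative of `s^{-k} G`
  let R : ℝ × ℝ → ℂ := fun y => -(k : ℂ) * G y + y.1 * partialFst G y
  have hR : CylSchwartz R := (hG.const_mul _).add hG.partialFst.fst_mul
  have hRf : Flat R := (hf.mul_left contDiff_const).add (hf.partialFst.mul_left contDiff_ofReal_fst)
  have hS : ∀ c : ℂ, CylSchwartz fun y => c * R y + -1 / 2 * partialSnd G y := fun c =>
    (hR.const_mul c).add (hG.partialSnd.const_mul _)
  have hSf : ∀ c : ℂ, Flat fun y => c * R y + -1 / 2 * partialSnd G y := fun c =>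
    (hRf.mul_left contDiff_const).add (hf.partialSnd.mul_left contDiff_const)
  let G₁ : ℝ × ℝ → ℂ := fun y =>
    conj (unitDir y) * (-Complex.I / 2 * R y + -1 / 2 * partialSnd G y)
  let G₂ : ℝ × ℝ → ℂ := fun y => unitDir y * (Complex.I / 2 * R y + -1 / 2 * partialSnd G y)
  have hpolar : ∀ y : ℝ × ℝ, y.1 ≠ 0 → HasFDerivAt A
      ((((y.1 : ℂ) ^ (k + 1))⁻¹ * G₁ y) • ContinuousLinearMap.id ℝ ℂ +
        (((y.1 : ℂ) ^ (k + 1))⁻¹ * G₂ y) • (Complex.conjCLE : ℂ →L[ℝ] ℂ)) (polarPoint y) := by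
    intro y hy
    have hyc : (y.1 : ℂ) ≠ 0 := by exact_mod_cast hy
    have hpow : HasDerivAt (fun s : ℝ => ((s : ℂ) ^ k)⁻¹)
        (-(k : ℂ) * ((y.1 : ℂ) ^ (k + 1))⁻¹) y.1 := by
      have h₁ := ((Complex.ofRealCLM.hasDerivAt (x := y.1)).pow k).inv (by simp [hy])
      refine h₁.congr_deriv ?_
      rcases k with _ | k
      · simp
      · simp
        field_simp
        ring
    have hp : HasFDerivAt (fun y : ℝ × ℝ => ((y.1 : ℂ) ^ k)⁻¹)
        ((ContinuousLinearMap.toSpanSingleton ℝ (-(k : ℂ) * ((y.1 : ℂ) ^ (k + 1))⁻¹)).comp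
          (ContinuousLinearMap.fst ℝ ℝ ℝ)) y :=
      hpow.hasFDerivAt.comp y hasFDerivAt_fst
    have hQ := hp.mul (hG.hasPartials y)
    refine (hasFDerivAt_of_comp_polarPoint h (Q₁ := fun y => ((y.1 : ℂ) ^ (k + 1))⁻¹ * R y)
      (Q₂ := fun y => ((y.1 : ℂ) ^ k)⁻¹ * partialSnd G y) hy
      (hQ.congr_fderiv ?_)).congr_fderiv ?_
    · ext
      · simp [R]
        field_simp
        ring
      · simp
    · congr 2
      · simp only [G₁]
        field_simp
        ring
      · simp only [G₂]
        field_simp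
        ring
  have hconst : ∀ y, polarPoint y = polarPoint (polarCoords (polarPoint y)) := fun y =>
    (polarPoint_polarCoords _).symm
  have hfac : ∀ y : ℝ × ℝ,
      ((((polarCoords (polarPoint y)).1 : ℂ) ^ (k + 1))⁻¹ * G₁ (polarCoords (polarPoint y)) =
        ((y.1 : ℂ) ^ (k + 1))⁻¹ * G₁ y) ∧
      ((((polarCoords (polarPoint y)).1 : ℂ) ^ (k + 1))⁻¹ * G₂ (polarCoords (polarPoint y)) =
        ((y.1 : ℂ) ^ (k + 1))⁻¹ * G₂ y) := by
    intro y
    by_cases hy : y.1 = 0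
    · have : (polarCoords (polarPoint y)).1 = 0 := by
        rw [fst_polarCoords, norm_polarPoint, hy, abs_zero]
      simp [this, hy]
    · have h₁ := hpolar y hy
      have h₂ := hpolar (polarCoords (polarPoint y))
        (by rw [fst_polarCoords, norm_polarPoint]; simpa using hy)
      rw [← hconst] at h₂
      refine wirtinger_coeff_unique fun v => ?_
      simpa [mul_comm] using DFunLike.congr_fun (h₂.unique h₁) v
  refine ⟨fun w => (((polarCoords w).1 : ℂ) ^ (k + 1))⁻¹ * G₁ (polarCoords w),
    fun w => (((polarCoords w).1 : ℂ) ^ (k + 1))⁻¹ * G₂ (polarCoords w),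
    ⟨k + 1, G₁, (hS _).conj_mul, (hSf _).mul_left contDiff_conj_unitDir, fun y => (hfac y).1⟩,
    ⟨k + 1, G₂, (hS _).dir_mul, (hSf _).mul_left contDiff_unitDir, fun y => (hfac y).2⟩,
    fun w => ?_⟩
  by_cases hw : w = 0
  · subst hw
    -- At the origin `A w = O(|w|²)`.
    obtain ⟨C, hC₀, hC⟩ := hf.exists_bound_pow hG (k + 2)
    have hb : ∀ w, ‖A w‖ ≤ C * ‖w‖ ^ 2 := by
      intro w
      rw [← polarPoint_polarCoords w, h, norm_polarPoint, norm_mul, norm_inv, norm_pow,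
        Complex.norm_real, Real.norm_eq_abs]
      have hC' := hC (polarCoords w)
      have hC₂ : 0 ≤ C * |(polarCoords w).1| ^ 2 := by positivity
      calc (|(polarCoords w).1| ^ k)⁻¹ * ‖G (polarCoords w)‖
          ≤ (|(polarCoords w).1| ^ k)⁻¹ * (C * |(polarCoords w).1| ^ (k + 2)) := by gcongr
        _ = (|(polarCoords w).1| ^ k)⁻¹ * |(polarCoords w).1| ^ k *
            (C * |(polarCoords w).1| ^ 2) := by ring
        _ ≤ 1 * (C * |(polarCoords w).1| ^ 2) :=
            mul_le_mul_of_nonneg_right inv_mul_le_one hC₂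
        _ = _ := one_mul _
    have hO : A =O[nhds 0] fun w : ℂ => ‖w - 0‖ ^ 2 :=
      Asymptotics.IsBigO.of_bound C (.of_forall fun w => by simpa using hb w)
    refine (hO.hasFDerivAt one_lt_two).congr_fderiv ?_
    ext
    simp [fst_polarCoords]
  · have := hpolar (polarCoords w) (by simpa [fst_polarCoords] using hw)
    rwa [polarPoint_polarCoords] at this

/-- A flat Schwartz function on the cylinder that depends only on the point with polar coordinates
`(s, θ)` is a Schwartz function on the plane. -/
theorem exists_schwartzMap_of_flat {H : ℝ × ℝ → ℂ} (hH : CylSchwartz H) (hf : Flat H)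
    (hfac : ∀ y y', polarPoint y = polarPoint y' → H y = H y') :
    ∃ A : 𝓢(ℂ, ℂ), ∀ y, A (polarPoint y) = H y := by
  have hA : ∀ y, H (polarCoords (polarPoint y)) = H y := fun y =>
    hfac _ _ (polarPoint_polarCoords _)
  have hq : FlatQuotient fun w => H (polarCoords w) := ⟨0, H, hH, hf, fun y => by simp [hA y]⟩
  refine ⟨⟨fun w => H (polarCoords w), contDiff_of_closed_hasFDerivAt _ _
    (fun _ h => h.hasFDerivAt) hq, fun a n => ?_⟩, hA⟩
  exact bounded_iteratedFDeriv_of_closed_hasFDerivAt _ _ (fun _ h => h.hasFDerivAt)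
    (W := fun w => ‖w‖ ^ a) (fun w => by positivity) (fun _ h => h.bound a) n hq

/-! ### Borel's lemma on the plane -/

theorem iteratedDeriv_comp_line {f : ℂ → ℂ} (hf : ContDiff ℝ ∞ f) (j : ℕ) (z : ℂ) :
    iteratedDeriv j (fun s : ℝ => f (s * z)) 0 = iteratedFDeriv ℝ j f 0 fun _ => z := by
  have h := (ContinuousLinearMap.toSpanSingleton ℝ z).iteratedFDeriv_comp_right hf 0 (i := j)
    (mod_cast le_top)
  have e : (f ∘ ContinuousLinearMap.toSpanSingleton ℝ z) = fun s : ℝ => f (s * z) := by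
    funext s; simp
  rw [e] at h
  rw [iteratedDeriv_eq_iteratedFDeriv, h]
  simp

theorem iteratedDeriv_ofReal_pow_mul_zero (j r : ℕ) (c : ℂ) :
    iteratedDeriv j (fun s : ℝ => (s : ℂ) ^ r * c) 0 = if r = j then j.factorial * c else 0 := by
  induction j generalizing r c with
  | zero =>
    rcases r with _ | r <;> simp
  | succ j ih =>
    rw [iteratedDeriv_succ']
    have hd : deriv (fun s : ℝ => (s : ℂ) ^ r * c) = fun s : ℝ => (s : ℂ) ^ (r - 1) * (r * c) := by
      funext s
      have h := ((Complex.ofRealCLM.hasDerivAt (x := s)).pow r).mul_const c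
      refine Eq.trans h.deriv ?_
      simp; ring
    rw [hd, ih]
    rcases r with _ | r
    · simp
    · by_cases h : r = j
      · subst h
        simp [Nat.factorial_succ]
        ring
      · simp [h]

/-- Borel's lemma: a Schwartz function on the plane may have any prescribed Taylor expansion at the
origin; the homogeneous component of degree `r` is the function `q r`. -/
theorem exists_schwartzMap_taylor (q : ℕ → ℂ → ℂ) (hq : ∀ r, ContDiff ℝ ∞ (q r))
    (hh : ∀ (r : ℕ) (s : ℝ) (w : ℂ), q r (s * w) = (s : ℂ) ^ r * q r w) :
    ∃ b : 𝓢(ℂ, ℂ), ∀ (j : ℕ) (z : ℂ),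
      iteratedDeriv j (fun s : ℝ => b (s * z)) 0 = j.factorial * q j z := by
  -- The function is `∑ (l r)^{-r} (χ q_r)(l r • w)`, whose terms equal `q_r` near the origin.
  let χ : ContDiffBump (0 : ℂ) := ⟨1, 2, one_pos, one_lt_two⟩
  let G : ℕ → ℂ → ℂ := fun r w => (χ w : ℂ) * q r w
  have hG : ∀ r, ContDiff ℝ ∞ (G r) := fun r =>
    (Complex.ofRealCLM.contDiff.comp χ.contDiff).mul (hq r)
  have hzero : ∀ r w, 2 ≤ ‖w‖ → G r w = 0 := by
    intro r w hw
    simp [G, χ.zero_of_le_dist (x := w) (by simpa [χ] using hw)]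
  have hGc : ∀ r, HasCompactSupport (G r) := fun r =>
    HasCompactSupport.intro (isCompact_closedBall 0 2) fun w hw => hzero r w (by
      simp at hw; exact hw.le)
  have hM : ∀ k r, ∃ C : ℝ, ∀ w, ‖iteratedFDeriv ℝ k (G r) w‖ ≤ C := fun k r =>
    ((hGc r).iteratedFDeriv k).exists_bound_of_continuous
      ((hG r).continuous_iteratedFDeriv (mod_cast le_top))
  choose M hM using hM
  have hM₀ : ∀ k r, 0 ≤ M k r := fun k r => (norm_nonneg _).trans (hM k r 0)
  -- The scale is chosen so that all derivatives of order `k < r` of the term `r` are at most `2⁻ʳ`.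
  let l : ℕ → ℝ := fun r => 1 + 2 ^ r * ∑ k ∈ Finset.range r, M k r
  have hl : ∀ r, 1 ≤ l r := fun r => by
    have : 0 ≤ ∑ k ∈ Finset.range r, M k r := Finset.sum_nonneg fun k _ => hM₀ k r
    simp only [l]
    nlinarith [pow_pos (two_pos (α := ℝ)) r]
  have hl₀ : ∀ r, 0 < l r := fun r => one_pos.trans_le (hl r)
  let f : ℕ → ℂ → ℂ := fun r w => ((l r)⁻¹ ^ r) • G r (l r • w)
  have hf : ∀ r, ContDiff ℝ ∞ (f r) := fun r =>
    ((hG r).comp (contDiff_const_smul _)).const_smul _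
  let v : ℕ → ℕ → ℝ := fun k r => (l r)⁻¹ ^ r * (l r ^ k * M k r)
  have hv : ∀ k, Summable (v k) := by
    intro k
    refine Summable.of_norm_bounded_eventually_nat summable_geometric_two ?_
    filter_upwards [Filter.eventually_gt_atTop k] with r hr
    have h₁ : M k r * 2 ^ r ≤ l r := by
      have : M k r ≤ ∑ k ∈ Finset.range r, M k r :=
        Finset.single_le_sum (f := fun k => M k r) (fun k _ => hM₀ k r) (by simpa using hr)
      simp only [l]
      nlinarith [pow_pos (two_pos (α := ℝ)) r]
    have h₂ : (l r)⁻¹ ^ r * l r ^ k ≤ (l r)⁻¹ := by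
      have : (l r)⁻¹ ^ r * l r ^ k = (l r)⁻¹ ^ (r - k) := by
        rw [← pow_sub_mul_pow (l r)⁻¹ hr.le, mul_assoc, ← mul_pow, inv_mul_cancel₀ (hl₀ r).ne',
          one_pow, mul_one]
      rw [this]
      exact pow_le_of_le_one (inv_nonneg.2 (hl₀ r).le) (inv_le_one_of_one_le₀ (hl r)) (by omega)
    have hnn : 0 ≤ v k r := by
      have := hl₀ r; have := hM₀ k r; positivity
    rw [Real.norm_of_nonneg hnn]
    calc v k r = ((l r)⁻¹ ^ r * l r ^ k) * M k r := by simp only [v]; ring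
      _ ≤ (l r)⁻¹ * M k r := mul_le_mul_of_nonneg_right h₂ (hM₀ k r)
      _ ≤ (1 / 2) ^ r := by
        rw [one_div, inv_pow, inv_mul_le_iff₀ (hl₀ r), ← div_eq_mul_inv, le_div_iff₀ (by positivity)]
        exact h₁
  have hfv : ∀ (k r : ℕ) (w : ℂ), ‖iteratedFDeriv ℝ k (f r) w‖ ≤ v k r := by
    intro k r w
    have h₁ : ContDiff ℝ k (G r) := (hG r).of_le (mod_cast le_top)
    have h₂ : ContDiff ℝ k fun w => G r (l r • w) := h₁.comp (contDiff_const_smul _)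
    have : iteratedFDeriv ℝ k (f r) w = (l r)⁻¹ ^ r • iteratedFDeriv ℝ k (fun w => G r (l r • w)) w :=
      iteratedFDeriv_const_smul_apply' h₂.contDiffAt
    rw [this, iteratedFDeriv_comp_const_smul _ h₁, norm_smul, norm_smul, norm_pow, norm_pow,
      norm_inv, Real.norm_of_nonneg (hl₀ r).le]
    have := hl₀ r
    simp only [v]
    gcongr
    exact hM k r _
  have hsm : ContDiff ℝ ∞ fun w => ∑' r, f r w :=
    contDiff_tsum hf (fun k _ => hv k) fun k r w _ => hfv k r w
  have hcs : HasCompactSupport fun w => ∑' r, f r w := by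
    refine HasCompactSupport.intro (isCompact_closedBall 0 2) fun w hw => ?_
    have hw' : 2 < ‖w‖ := by simpa using hw
    have : ∀ r, f r w = 0 := by
      intro r
      have h : 2 ≤ ‖l r • w‖ := by
        rw [norm_smul, Real.norm_of_nonneg (hl₀ r).le]
        nlinarith [hl r]
      simp only [f, hzero r _ h, smul_zero]
    simp [this]
  refine ⟨hcs.toSchwartzMap hsm, fun j z => ?_⟩
  change iteratedDeriv j (fun s : ℝ => (fun w => ∑' r, f r w) (s * z)) 0 = _
  rw [iteratedDeriv_comp_line hsm, iteratedFDeriv_tsum_apply hf (fun k _ => hv k)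
    (fun k r w _ => hfv k r w) (mod_cast le_top)]
  have hs : Summable fun r => iteratedFDeriv ℝ j (f r) 0 :=
    Summable.of_norm_bounded (hv j) fun r => hfv j r 0
  have hev := (ContinuousMultilinearMap.apply ℝ (fun _ : Fin j => ℂ) ℂ fun _ => z).map_tsum hs
  simp only [ContinuousMultilinearMap.apply_apply] at hev
  rw [hev]
  have hterm : ∀ r, (iteratedFDeriv ℝ j (f r) 0 fun _ => z) =
      if r = j then j.factorial * q r z else 0 := by
    intro r
    rw [← iteratedDeriv_comp_line (hf r), ← iteratedDeriv_ofReal_pow_mul_zero]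
    refine Filter.EventuallyEq.iteratedDeriv_eq j ?_
    have hc : Filter.Tendsto (fun s : ℝ => l r • (s * z : ℂ)) (nhds 0) (nhds 0) := by
      have : Continuous fun s : ℝ => l r • (s * z : ℂ) := by fun_prop
      simpa using this.tendsto 0
    filter_upwards [hc (Metric.closedBall_mem_nhds 0 one_pos)] with s hs
    have h₁ : χ (l r • (s * z : ℂ)) = 1 := χ.one_of_mem_closedBall hs
    have h₂ : (l r • (s * z : ℂ)) = ((l r * s : ℝ) : ℂ) * z := by simp [mul_assoc]
    have h₃ : (l r : ℂ) ≠ 0 := by exact_mod_cast (hl₀ r).ne'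
    simp only [f, G, h₁]
    rw [h₂, hh]
    simp [mul_pow]
    field_simp
  simp only [hterm]
  rw [tsum_ite_eq]

/-- The iterated partial derivative in `s` as a one-variable derivative. -/
theorem iterate_partialFst_eq_iteratedDeriv {G : ℝ × ℝ → ℂ} (hG : ContDiff ℝ ∞ G) (j : ℕ)
    (s θ : ℝ) : partialFst^[j] G (s, θ) = iteratedDeriv j (fun s => G (s, θ)) s := by
  induction j generalizing G with
  | zero => simp
  | succ j ih =>
    rw [Function.iterate_succ_apply, ih (contDiff_partialFst hG), iteratedDeriv_succ']
    congr 1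
    funext s
    have hl : HasDerivAt (fun s : ℝ => (s, θ)) (1, 0) s :=
      (hasDerivAt_id s).prodMk (hasDerivAt_const s θ)
    exact ((hG.differentiable (by simp) (s, θ)).hasFDerivAt.comp_hasDerivAt s hl).deriv.symm

/-! ### Functions on the cylinder that satisfy the moment conditions -/

/-- A homogeneous polynomial of degree `N + r` in `ζ, ζ̄` is a combination of the monomials
`ζ^m ζ̄^(N-m)` whose coefficients are homogeneous of degree `r`. -/
theorem MvPolynomial.IsHomogeneous.exists_split {N r : ℕ} {P : MvPolynomial (Fin 2) ℂ}
    (hP : P.IsHomogeneous (N + r)) : ∃ q : ℕ → ℂ → ℂ, (∀ m, ContDiff ℝ ∞ (q m)) ∧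
      (∀ (m : ℕ) (s : ℝ) (w : ℂ), q m (s * w) = (s : ℂ) ^ r * q m w) ∧
      ∀ ζ : ℂ, MvPolynomial.eval ![ζ, conj ζ] P =
        ∑ m ∈ Finset.range (N + 1), ζ ^ m * conj ζ ^ (N - m) * q m ζ := by
  have hdeg : ∀ d ∈ P.support, d 0 + d 1 = N + r := by
    intro d hd
    have h := hP (MvPolynomial.mem_support_iff.1 hd)
    rw [Finsupp.weight_apply, Finsupp.sum_fintype _ _ (by simp)] at h
    simpa using h
  refine ⟨fun m w => ∑ d ∈ P.support, if min (d 0) N = m then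
    P.coeff d * (w ^ (d 0 - m) * conj w ^ (d 1 - (N - m))) else 0, fun m => ?_, fun m s w => ?_,
    fun ζ => ?_⟩
  · have hc : ContDiff ℝ ∞ fun w : ℂ => conj w := Complex.conjCLE.contDiff
    refine ContDiff.sum fun d _ => ?_
    split_ifs
    · exact contDiff_const.mul ((contDiff_id.pow _).mul (hc.pow _))
    · exact contDiff_const
  · rw [Finset.mul_sum]
    refine Finset.sum_congr rfl fun d hd => ?_
    split_ifs with hm
    · have h : r = (d 0 - m) + (d 1 - (N - m)) := by have := hdeg d hd; omega
      conv_rhs => rw [h, pow_add]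
      simp only [map_mul, Complex.conj_ofReal, mul_pow]
      ring
    · simp
  · rw [MvPolynomial.eval_eq']
    simp only [Finset.mul_sum]
    rw [Finset.sum_comm]
    refine Finset.sum_congr rfl fun d hd => ?_
    simp only [mul_ite, mul_zero]
    rw [Finset.sum_ite_eq, if_pos (by simp)]
    have h₀ : d 0 = min (d 0) N + (d 0 - min (d 0) N) := by omega
    have h₁ : d 1 = (N - min (d 0) N) + (d 1 - (N - min (d 0) N)) := by
      have := hdeg d hd; omega
    simp only [Fin.prod_univ_two, Matrix.cons_val_zero, Matrix.cons_val_one]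
    conv_lhs => rw [h₀, h₁, pow_add, pow_add]
    ring

theorem CylSchwartz.monomial_mul {H : ℝ × ℝ → ℂ} (h : CylSchwartz H) (m n : ℕ) :
    CylSchwartz fun y => unitDir y ^ m * conj (unitDir y) ^ n * H y := by
  induction m with
  | zero =>
    induction n with
    | zero => simpa using h
    | succ n ih => simpa [pow_succ', mul_assoc] using ih.conj_mul
  | succ m ih => simpa [pow_succ', mul_assoc] using ih.dir_mul

theorem iterate_partialFst_oscTransform {H : ℝ × ℝ → ℂ} (h : CylSchwartz H) (c : ℝ) (j : ℕ) :
    partialFst^[j] (oscTransform c H) = oscTransform c fun y => (Complex.I * c * y.1) ^ j * H y := by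
  induction j generalizing H with
  | zero => simp
  | succ j ih =>
    rw [Function.iterate_succ_apply, (h.hasPartials_oscTransform c).eq.1,
      ih (h.fst_mul.const_mul _)]
    congr 1
    funext y
    ring

open FourierTransform in
theorem oscTransform_oscTransform {ψ : ℝ × ℝ → ℂ} (h : CylSchwartz ψ) :
    oscTransform (-(2 * Real.pi)) (oscTransform (2 * Real.pi) ψ) = ψ := by
  funext ⟨p, θ⟩
  have hinv : 𝓕⁻ (fun p : ℝ => ψ (p, θ)) = fun s => oscTransform (2 * Real.pi) ψ (s, θ) := by
    funext s
    rw [Real.fourierInv_eq']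
    refine integral_congr_ae (.of_forall fun r => ?_)
    simp only [smul_eq_mul, RCLike.inner_apply, conj_trivial]
    congr 2
    push_cast
    ring
  have hosc : CylSchwartz (oscTransform (2 * Real.pi) ψ) := h.oscTransform (by simp [Real.pi_ne_zero])
  have key := fourier_fourierInv_eq_of_integrable (f := fun p : ℝ => ψ (p, θ))
    (h.continuous.comp (by fun_prop)) (h.integrable θ) (by rw [hinv]; exact hosc.integrable θ)
  rw [hinv] at key
  refine Eq.trans ?_ (congrFun key p)
  rw [Real.fourier_eq']
  refine integral_congr_ae (.of_forall fun s => ?_)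
  simp only [smul_eq_mul, RCLike.inner_apply, conj_trivial]
  congr 2
  push_cast
  ring

/-- `unitDir` does not depend on the first coordinate. -/
theorem unitDir_eq (s s' θ : ℝ) : unitDir (s, θ) = unitDir (s', θ) := rfl

/-- Polar coordinates are unique up to the sign of `s`, except at the origin. -/
theorem polarPoint_eq_cases {y y' : ℝ × ℝ} (h : polarPoint y = polarPoint y') :
    (y.1 = 0 ∧ y'.1 = 0) ∨ (y'.1 = y.1 ∧ unitDir y' = unitDir y) ∨
      (y'.1 = -y.1 ∧ unitDir y' = -unitDir y) := by
  have habs : |y.1| = |y'.1| := by rw [← norm_polarPoint, ← norm_polarPoint, h]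
  by_cases hy : y.1 = 0
  · exact .inl ⟨hy, by simpa [hy] using habs.symm⟩
  have hyc : Complex.I * (y.1 : ℂ) ≠ 0 := by simp [hy]
  simp only [polarPoint] at h
  rcases abs_eq_abs.1 habs.symm with h' | h'
  · refine .inr (.inl ⟨h', mul_left_cancel₀ hyc ?_⟩)
    rw [h, h']
  · refine .inr (.inr ⟨h', mul_left_cancel₀ hyc ?_⟩)
    rw [mul_neg, h, h']
    push_cast
    ring

/-- The parity of a function on the cylinder passes to its Fourier transform in `p`. -/
theorem oscTransform_neg {ψ : ℝ × ℝ → ℂ} {N : ℕ} {θ θ' : ℝ}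
    (h : ∀ p, ψ (-p, θ') = (-1) ^ N * ψ (p, θ)) (c s : ℝ) :
    oscTransform c ψ (-s, θ') = (-1) ^ N * oscTransform c ψ (s, θ) := by
  simp only [oscTransform]
  rw [← integral_const_mul, ← integral_neg_eq_self]
  refine integral_congr_ae (.of_forall fun p => ?_)
  simp only [h]
  push_cast
  ring_nf

open FourierTransform in
/-- The range theorem on the cylinder: parity and moment conditions produce a representation by ray
transforms, with the weights `ζ^m ζ̄^(N-m)`. -/
theorem exists_eq_sum_rayTransform (N : ℕ) {ψ : ℝ × ℝ → ℂ} (hψ : CylSchwartz ψ)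
    (hdep : ∀ p θ θ' : ℝ, unitDir (0, θ') = unitDir (0, θ) → ψ (p, θ') = ψ (p, θ))
    (hpar : ∀ p θ θ' : ℝ, unitDir (0, θ') = -unitDir (0, θ) → ψ (-p, θ') = (-1) ^ N * ψ (p, θ))
    (hmom : ∀ r : ℕ, ∃ P : MvPolynomial (Fin 2) ℂ, P.IsHomogeneous (N + r) ∧ ∀ θ : ℝ,
      ∫ p : ℝ, (p : ℂ) ^ r * ψ (p, θ) =
        MvPolynomial.eval ![unitDir (0, θ), conj (unitDir (0, θ))] P) :
    ∃ a : ℕ → 𝓢(ℂ, ℂ), ∀ y, ψ y = ∑ m ∈ Finset.range (N + 1),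
      unitDir y ^ m * conj (unitDir y) ^ (N - m) * rayTransform (a m) y := by
  choose P hP hPψ using hmom
  choose q hqs hqh hqP using fun r => (hP r).exists_split
  set g := oscTransform (2 * Real.pi) ψ with hg
  have hgC : CylSchwartz g := hψ.oscTransform (by simp [Real.pi_ne_zero])
  let c : ℂ := Complex.I * (2 * Real.pi : ℝ)
  -- The rotation by `-i` undoes the factor `i` in `polarPoint`.
  have hborel : ∀ m, ∃ b : 𝓢(ℂ, ℂ), ∀ (j : ℕ) (z : ℂ),
      iteratedDeriv j (fun s : ℝ => b (s * z)) 0 =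
        j.factorial * (c ^ j / j.factorial * q j m (-Complex.I * z)) := fun m =>
    exists_schwartzMap_taylor (fun r w => c ^ r / r.factorial * q r m (-Complex.I * w))
      (fun r => contDiff_const.mul ((hqs r m).comp (contDiff_const.mul contDiff_id)))
      (fun r s w => by
        rw [mul_left_comm (-Complex.I), hqh]; ring)
  choose b hb using hborel
  let H : ℝ × ℝ → ℂ := fun y => g y + -1 * ∑ m ∈ Finset.range (N + 1),
    unitDir y ^ m * conj (unitDir y) ^ (N - m) * b m (polarPoint y)
  have hHC : CylSchwartz H := hgC.add ((CylSchwartz.sum _ fun m _ =>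
    (b m).cylSchwartz_comp_polarPoint.monomial_mul m (N - m)).const_mul _)
  have hHf : Flat H := by
    refine ⟨hHC.1, fun j θ => ?_⟩
    rw [iterate_partialFst_eq_iteratedDeriv hHC.1]
    set u := unitDir (0, θ) with hu
    have hpt : ∀ s : ℝ, polarPoint (s, θ) = s * (Complex.I * u) := fun s => by
      simp only [polarPoint, hu, unitDir]; ring
    have hline : ContDiff ℝ ∞ fun s : ℝ => (s, θ) := contDiff_id.prodMk contDiff_const
    have hgs : ContDiff ℝ ∞ fun s : ℝ => g (s, θ) := hgC.1.comp hline
    have hbs : ∀ m, ContDiff ℝ ∞ fun s : ℝ => b m (s * (Complex.I * u)) := fun m => by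
      have := (b m).cylSchwartz_comp_polarPoint.1.comp hline
      simpa only [Function.comp_def, hpt] using this
    have hle : ∀ j : ℕ, (j : ℕ∞ω) ≤ ∞ := fun j => mod_cast le_top
    have e : (fun s : ℝ => H (s, θ)) = fun s => g (s, θ) + -1 * ∑ m ∈ Finset.range (N + 1),
        u ^ m * conj u ^ (N - m) * b m (s * (Complex.I * u)) := by
      funext s
      simp only [H, hpt, unitDir_eq s 0 θ, ← hu]
    have hsum : ContDiff ℝ ∞ fun s : ℝ => ∑ m ∈ Finset.range (N + 1),
        u ^ m * conj u ^ (N - m) * b m (s * (Complex.I * u)) :=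
      ContDiff.sum fun m _ => contDiff_const.mul (hbs m)
    -- The Taylor coefficients of `g` are the moments of `ψ`.
    have hgj : iteratedDeriv j (fun s => g (s, θ)) 0 =
        c ^ j * ∑ m ∈ Finset.range (N + 1), u ^ m * conj u ^ (N - m) * q j m u := by
      rw [← iterate_partialFst_eq_iteratedDeriv hgC.1, hg,
        iterate_partialFst_oscTransform hψ, ← hqP, ← hPψ, oscTransform, ← integral_const_mul]
      refine integral_congr_ae (.of_forall fun p => ?_)
      simp [c, mul_pow]
      ring
    have hI : -Complex.I * (Complex.I * u) = u := by
      linear_combination (-u) * Complex.I_mul_I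
    rw [e, iteratedDeriv_fun_add (hgs.of_le (hle j)).contDiffAt
      ((contDiff_const.mul hsum).of_le (hle j)).contDiffAt, iteratedDeriv_const_mul_field,
      iteratedDeriv_fun_sum fun m _ =>
        ((contDiff_const.mul (hbs m)).of_le (hle j)).contDiffAt, hgj, Finset.mul_sum,
      Finset.mul_sum, ← Finset.sum_add_distrib]
    refine Finset.sum_eq_zero fun m _ => ?_
    rw [iteratedDeriv_const_mul_field, hb, hI]
    have : (j.factorial : ℂ) ≠ 0 := by exact_mod_cast j.factorial_ne_zero
    field_simp
    ring
  -- `H` has the parity of `N`, so `ζ^N H` is a function of `polarPoint y`.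
  let F : ℝ × ℝ → ℂ := fun y => unitDir y ^ N * H y
  have hFC : CylSchwartz F := by simpa [F] using hHC.monomial_mul N 0
  have hFf : Flat F := hHf.mul_left (contDiff_unitDir.pow N)
  have hfac : ∀ y y', polarPoint y = polarPoint y' → F y = F y' := by
    rintro ⟨s, θ⟩ ⟨s', θ'⟩ h
    rcases polarPoint_eq_cases h with ⟨h₁, h₂⟩ | ⟨h₁, h₂⟩ | ⟨h₁, h₂⟩
    · simp only at h₁ h₂
      have h₃ : ∀ θ, F (0, θ) = 0 := fun θ => hFf.2 0 θ
      rw [h₁, h₂, h₃, h₃]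
    · simp only at h₁
      subst h₁
      have h₃ : g (s', θ') = g (s', θ) := by
        simp only [hg, oscTransform]
        simp only [hdep _ θ θ' h₂]
      simp only [F, H, ← h, h₂, h₃]
    · simp only at h₁
      subst h₁
      have h₃ : g (-s, θ') = (-1) ^ N * g (s, θ) :=
        oscTransform_neg (fun p => hpar p θ θ' h₂) _ _
      have h₄ : ∀ m ∈ Finset.range (N + 1), (-unitDir (s, θ)) ^ m *
          conj (-unitDir (s, θ)) ^ (N - m) * b m (polarPoint (s, θ)) = (-1) ^ N *
          (unitDir (s, θ) ^ m * conj (unitDir (s, θ)) ^ (N - m) * b m (polarPoint (s, θ))) := by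
        intro m hm
        have : N = m + (N - m) := by simp at hm; omega
        conv_rhs => rw [this, pow_add]
        simp only [map_neg, Nat.add_sub_cancel_left]
        rw [neg_pow (unitDir (s, θ)), neg_pow (conj (unitDir (s, θ)))]
        ring
      have h₅ : ((-1 : ℂ) ^ N) * (-1) ^ N = 1 := by rw [← mul_pow]; simp
      simp only [F, H, ← h, h₂, h₃]
      rw [Finset.sum_congr rfl h₄, ← Finset.mul_sum, neg_pow (unitDir (s, θ))]
      linear_combination (-(unitDir (s, θ) ^ N * (g (s, θ) + -1 * ∑ m ∈ Finset.range (N + 1),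
        unitDir (s, θ) ^ m * conj (unitDir (s, θ)) ^ (N - m) * b m (polarPoint (s, θ))))) * h₅
  obtain ⟨A, hA⟩ := exists_schwartzMap_of_flat hFC hFf hfac
  let B : ℕ → 𝓢(ℂ, ℂ) := fun m => if m = 0 then b 0 + A else b m
  have hgB : g = fun y => ∑ m ∈ Finset.range (N + 1),
      unitDir y ^ m * conj (unitDir y) ^ (N - m) * B m (polarPoint y) := by
    funext y
    have hu : unitDir y ^ N * conj (unitDir y) ^ N = 1 := by
      rw [← mul_pow, unitDir_mul_conj, one_pow]
    have hAy := hA y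
    simp only [F, H] at hAy
    rw [Finset.sum_range_succ'] at hAy ⊢
    simp only [B, Nat.succ_ne_zero, if_false, if_true, pow_zero, one_mul, Nat.sub_zero,
      _root_.add_apply] at hAy ⊢
    rw [hAy]
    linear_combination (-(g y - (∑ m ∈ Finset.range N, unitDir y ^ (m + 1) *
      conj (unitDir y) ^ (N - (m + 1)) * b (m + 1) (polarPoint y) +
      conj (unitDir y) ^ N * b 0 (polarPoint y)))) * hu
  refine ⟨fun m => 𝓕 (B m), fun ⟨p, θ⟩ => ?_⟩
  rw [← congrFun (oscTransform_oscTransform hψ) (p, θ), ← hg, hgB, oscTransform]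
  simp only [SchwartzMap.rayTransform_fourier, Finset.mul_sum]
  rw [integral_finsetSum _ fun m _ => by
    exact ((B m).cylSchwartz_comp_polarPoint.monomial_mul m (N - m)).integrable_phase_mul
      (-(2 * Real.pi)) (p, θ)]
  refine Finset.sum_congr rfl fun m _ => ?_
  rw [oscTransform, ← integral_const_mul]
  refine integral_congr_ae (.of_forall fun s => ?_)
  simp only [unitDir_eq s p θ]
  ring

/-! ### Mixed tensor fields -/

/-- The weight of the component with indices `i`, `j` in the mixed ray transform of direction `ζ`. -/
noncomputable def tensorWeight {k ℓ : ℕ} (ζ : ℂ) (i : Fin k → Fin 2) (j : Fin ℓ → Fin 2) : ℂ :=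
  (∏ a : Fin k, (planeCoord ζ (i a) : ℂ)) *
    (∏ b : Fin ℓ, (planeCoord (Complex.I * ζ) (j b) : ℂ))

theorem mixedRayTransform_ofParam {k ℓ : ℕ} (f : SchwartzTensorField k ℓ) (y : ℝ × ℝ)
    (h : ‖unitDir y‖ = 1) :
    mixedRayTransform f (TangentCircle.ofParam y.1 (unitDir y) h) =
      ∑ i, ∑ j, tensorWeight (unitDir y) i j * rayTransform (f.1 i j) y := by
  have hp : Complex.I * y.1 * unitDir y = polarPoint y := rfl
  simp only [mixedRayTransform, TangentCircle.ofParam, rayTransform, hp]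
  rw [integral_finsetSum _ fun i _ => integrable_finsetSum _ fun j _ =>
    (((f.1 i j).integrable_line y).mul_const _).mul_const _]
  refine Finset.sum_congr rfl fun i _ => ?_
  rw [integral_finsetSum _ fun j _ => (((f.1 i j).integrable_line y).mul_const _).mul_const _]
  refine Finset.sum_congr rfl fun j _ => ?_
  rw [← integral_const_mul]
  refine integral_congr_ae (.of_forall fun t => ?_)
  simp only [tensorWeight]
  ring

theorem ofParam_congr {p p' : ℝ} {ζ ζ' : ℂ} (hp : p = p') (h : ζ = ζ') (hζ : ‖ζ‖ = 1)
    (hζ' : ‖ζ'‖ = 1) : TangentCircle.ofParam p ζ hζ = TangentCircle.ofParam p' ζ' hζ' := by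
  subst hp; subst h; rfl

/-- The coordinates of a vector as linear forms in `ζ, ζ̄`. -/
theorem exists_planeCoord_poly (ζ₀ : ℂ) (i : Fin 2) : ∃ c d : ℂ, ∀ ζ : ℂ,
    (planeCoord (ζ₀ * ζ) i : ℂ) = c * ζ + d * conj ζ := by
  fin_cases i
  · refine ⟨ζ₀ / 2, conj ζ₀ / 2, fun ζ => ?_⟩
    simp only [planeCoord, Fin.zero_eta, Matrix.cons_val_zero, Complex.re_eq_add_conj, map_mul]
    ring
  · refine ⟨ζ₀ / (2 * Complex.I), -conj ζ₀ / (2 * Complex.I), fun ζ => ?_⟩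
    change ((ζ₀ * ζ).im : ℂ) = _
    rw [Complex.im_eq_sub_conj, map_mul]
    ring

theorem exists_prod_planeCoord_poly {n : ℕ} (ζ₀ : ℂ) (i : Fin n → Fin 2) :
    ∃ P : MvPolynomial (Fin 2) ℂ, P.IsHomogeneous n ∧ ∀ ζ : ℂ,
      ∏ a, (planeCoord (ζ₀ * ζ) (i a) : ℂ) = MvPolynomial.eval ![ζ, conj ζ] P := by
  choose c d h using fun a => exists_planeCoord_poly ζ₀ (i a)
  refine ⟨∏ a, (MvPolynomial.C (c a) * MvPolynomial.X 0 + MvPolynomial.C (d a) *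
    MvPolynomial.X 1), ?_, fun ζ => ?_⟩
  · have := MvPolynomial.IsHomogeneous.prod Finset.univ
      (fun a => MvPolynomial.C (c a) * MvPolynomial.X 0 + MvPolynomial.C (d a) *
        MvPolynomial.X (1 : Fin 2)) (fun _ => 1) fun a _ =>
      (MvPolynomial.isHomogeneous_C_mul_X (c a) 0).add (MvPolynomial.isHomogeneous_C_mul_X (d a) 1)
    simpa using this
  · simp [h, map_prod]

theorem exists_tensorWeight_poly {k ℓ : ℕ} (i : Fin k → Fin 2) (j : Fin ℓ → Fin 2) :
    ∃ P : MvPolynomial (Fin 2) ℂ, P.IsHomogeneous (k + ℓ) ∧ ∀ ζ : ℂ,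
      tensorWeight ζ i j = MvPolynomial.eval ![ζ, conj ζ] P := by
  obtain ⟨P, hP, h⟩ := exists_prod_planeCoord_poly 1 i
  obtain ⟨Q, hQ, h'⟩ := exists_prod_planeCoord_poly Complex.I j
  exact ⟨P * Q, hP.mul hQ, fun ζ => by simp [tensorWeight, ← h, ← h']⟩

theorem CylSchwartz.eval_mul {H : ℝ × ℝ → ℂ} (h : CylSchwartz H) (P : MvPolynomial (Fin 2) ℂ) :
    CylSchwartz fun y => MvPolynomial.eval ![unitDir y, conj (unitDir y)] P * H y := by
  simp only [MvPolynomial.eval_eq', Finset.sum_mul]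
  refine CylSchwartz.sum _ fun d _ => ?_
  simpa [mul_assoc] using (h.monomial_mul (d 0) (d 1)).const_mul (P.coeff d)

/-- The symmetric tensor of a product of linear forms. -/
theorem exists_symmetric_tensor {n : ℕ} (w : Fin n → Fin 2 → ℂ) :
    ∃ κ : (Fin n → Fin 2) → ℂ, (∀ (σ : Equiv.Perm (Fin n)) i, κ (i ∘ σ) = κ i) ∧
      ∀ x : Fin 2 → ℂ, ∑ i, κ i * ∏ a, x (i a) = ∏ a, ∑ e, w a e * x e := by
  have hn : (n.factorial : ℂ) ≠ 0 := by exact_mod_cast n.factorial_ne_zero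
  refine ⟨fun i => (n.factorial : ℂ)⁻¹ * ∑ τ : Equiv.Perm (Fin n), ∏ a, w (τ a) (i a),
    fun σ i => ?_, fun x => ?_⟩
  · refine congrArg _ (Fintype.sum_equiv (Equiv.mulRight σ⁻¹) _ _ fun τ => ?_)
    refine Fintype.prod_equiv σ _ _ fun a => ?_
    simp
  · have h : ∀ τ : Equiv.Perm (Fin n),
        ∑ i : Fin n → Fin 2, ∏ a, (w (τ a) (i a) * x (i a)) = ∏ a, ∑ e, w a e * x e := by
      intro τ
      rw [← Fintype.prod_sum (fun a e => w (τ a) e * x e)]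
      exact Fintype.prod_equiv τ _ _ fun a => rfl
    calc _ = (n.factorial : ℂ)⁻¹ * ∑ τ : Equiv.Perm (Fin n),
          ∑ i : Fin n → Fin 2, ∏ a, (w (τ a) (i a) * x (i a)) := by
          rw [Finset.sum_comm, Finset.mul_sum]
          refine Finset.sum_congr rfl fun i _ => ?_
          rw [mul_assoc, Finset.sum_mul]
          simp only [Finset.prod_mul_distrib]
      _ = _ := by
          simp only [h, Finset.sum_const, Finset.card_univ, Fintype.card_perm, Fintype.card_fin,
            nsmul_eq_mul]
          rw [inv_mul_cancel_left₀ hn]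

/-- Every monomial `ζ^m ζ̄^(k+ℓ-m)` is the contraction of a constant tensor, symmetric in both groups
of indices, with `ζ^k ⊗ (iζ)^ℓ`. -/
theorem exists_tensor_monomial (k ℓ m : ℕ) (hm : m ≤ k + ℓ) :
    ∃ κ : (Fin k → Fin 2) → (Fin ℓ → Fin 2) → ℂ,
      (∀ (σ : Equiv.Perm (Fin k)) (τ : Equiv.Perm (Fin ℓ)) i j, κ (i ∘ σ) (j ∘ τ) = κ i j) ∧
      ∀ ζ : ℂ, ∑ i, ∑ j, tensorWeight ζ i j * κ i j = ζ ^ m * conj ζ ^ (k + ℓ - m) := by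
  -- The first `m` of the `k + ℓ` factors are `ζ`, the others `ζ̄`; in the coordinates of `iζ` these
  -- are the forms `-iη₁ + η₂` and `iη₁ + η₂`.
  obtain ⟨κ, hκ, hκ'⟩ := exists_symmetric_tensor fun a : Fin k =>
    if (a : ℕ) < m then ![1, Complex.I] else ![1, -Complex.I]
  obtain ⟨κ₂, hκ₂, hκ₂'⟩ := exists_symmetric_tensor fun b : Fin ℓ =>
    if k + (b : ℕ) < m then ![-Complex.I, 1] else ![Complex.I, 1]
  refine ⟨fun i j => κ i * κ₂ j, fun σ τ i j => by simp only [hκ, hκ₂], fun ζ => ?_⟩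
  have h₁ := hκ' fun e => planeCoord ζ e
  have h₂ := hκ₂' fun e => planeCoord (Complex.I * ζ) e
  calc _ = (∑ i, κ i * ∏ a, (planeCoord ζ (i a) : ℂ)) *
        ∑ j, κ₂ j * ∏ b, (planeCoord (Complex.I * ζ) (j b) : ℂ) := by
        rw [Finset.sum_mul_sum]
        refine Finset.sum_congr rfl fun i _ => Finset.sum_congr rfl fun j _ => ?_
        simp only [tensorWeight]; ring
    _ = (∏ a : Fin k, if (a : ℕ) < m then ζ else conj ζ) *
        ∏ b : Fin ℓ, if k + (b : ℕ) < m then ζ else conj ζ := by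
        have hz : (ζ.re : ℂ) + Complex.I * ζ.im = ζ := by
          rw [mul_comm]; exact Complex.re_add_im ζ
        have hz' : conj ζ = ζ.re - Complex.I * ζ.im := by
          apply Complex.ext <;> simp
        rw [h₁, h₂]
        congr 1
        · refine Finset.prod_congr rfl fun a _ => ?_
          split_ifs
          · simpa [Fin.sum_univ_two, planeCoord] using hz
          · simp [Fin.sum_univ_two, planeCoord, hz']; ring
        · refine Finset.prod_congr rfl fun b _ => ?_
          split_ifs
          · simpa [Fin.sum_univ_two, planeCoord, add_comm] using hz
          · simp [Fin.sum_univ_two, planeCoord, hz']; ring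
    _ = ∏ a : Fin (k + ℓ), if (a : ℕ) < m then ζ else conj ζ := by
        rw [Fin.prod_univ_add]; rfl
    _ = _ := by
        rw [Fin.prod_univ_eq_prod_range (fun a => if a < m then ζ else conj ζ),
          ← Finset.prod_range_mul_prod_Ico _ hm,
          Finset.prod_congr rfl fun a ha => if_pos (Finset.mem_range.1 ha),
          Finset.prod_congr rfl fun a ha => if_neg (not_lt.2 (Finset.mem_Ico.1 ha).1)]
        simp

theorem rayTransform_sum_smul {ι : Type*} (s : Finset ι) (κ : ι → ℂ) (a : ι → 𝓢(ℂ, ℂ))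
    (y : ℝ × ℝ) : rayTransform (∑ m ∈ s, κ m • a m : 𝓢(ℂ, ℂ)) y =
      ∑ m ∈ s, κ m * rayTransform (a m) y := by
  simp only [rayTransform, ← integral_const_mul]
  rw [← integral_finsetSum _ fun m _ => ((a m).integrable_line y).const_mul (κ m)]
  refine integral_congr_ae (.of_forall fun t => ?_)
  simp

/-- Every combination of ray transforms with the weights `ζ^m ζ̄^(k+ℓ-m)` is the mixed ray transform
of a tensor field. -/
theorem exists_tensorField (k ℓ : ℕ) (a : ℕ → 𝓢(ℂ, ℂ)) : ∃ f : SchwartzTensorField k ℓ,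
    ∀ y, ∑ i, ∑ j, tensorWeight (unitDir y) i j * rayTransform (f.1 i j) y =
      ∑ m ∈ Finset.range (k + ℓ + 1),
        unitDir y ^ m * conj (unitDir y) ^ (k + ℓ - m) * rayTransform (a m) y := by
  choose! κ hκ hκ' using fun m (hm : m ≤ k + ℓ) => exists_tensor_monomial k ℓ m hm
  refine ⟨⟨fun i j => ∑ m ∈ Finset.range (k + ℓ + 1), κ m i j • a m, fun σ τ i j => ?_⟩,
    fun y => ?_⟩
  · refine Finset.sum_congr rfl fun m hm => ?_
    rw [hκ m (by simpa [Nat.lt_succ_iff] using hm)]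
  · simp only [rayTransform_sum_smul, Finset.mul_sum]
    simp only [Finset.sum_comm (s := Finset.univ) (t := Finset.range (k + ℓ + 1))]
    refine Finset.sum_congr rfl fun m hm => ?_
    rw [← hκ' m (by simpa [Nat.lt_succ_iff] using hm), Finset.sum_mul]
    refine Finset.sum_congr rfl fun i _ => ?_
    rw [Finset.sum_mul]
    refine Finset.sum_congr rfl fun j _ => ?_
    ring

/-! ### The range of the mixed ray transform -/

theorem inCoords_mixedRayTransform {k ℓ : ℕ} (f : SchwartzTensorField k ℓ) :
    TangentCircle.inCoords (mixedRayTransform f) = fun y =>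
      ∑ i, ∑ j, tensorWeight (unitDir y) i j * rayTransform (f.1 i j) y :=
  funext fun y => mixedRayTransform_ofParam f y (norm_unitDir y)

theorem isSchwartz_mixedRayTransform {k ℓ : ℕ} (f : SchwartzTensorField k ℓ) :
    TangentCircle.IsSchwartz (mixedRayTransform f) := by
  rw [TangentCircle.isSchwartz_iff, inCoords_mixedRayTransform]
  refine CylSchwartz.sum _ fun i _ => CylSchwartz.sum _ fun j _ => ?_
  obtain ⟨P, -, h⟩ := exists_tensorWeight_poly i j
  simp only [h]
  exact (f.1 i j).cylSchwartz_rayTransform.eval_mul P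

theorem planeCoord_neg (ξ : ℂ) (e : Fin 2) : planeCoord (-ξ) e = -planeCoord ξ e := by
  fin_cases e <;> simp [planeCoord]

theorem mixedRayTransform_reverse {k ℓ : ℕ} (f : SchwartzTensorField k ℓ) (q : TangentCircle) :
    mixedRayTransform f q.reverse = (-1) ^ (k + ℓ) * mixedRayTransform f q := by
  simp only [mixedRayTransform, TangentCircle.reverse]
  rw [← integral_neg_eq_self, ← integral_const_mul]
  refine integral_congr_ae (.of_forall fun t => ?_)
  simp only [Finset.mul_sum]
  refine Finset.sum_congr rfl fun i _ => Finset.sum_congr rfl fun j _ => ?_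
  simp only [mul_neg, planeCoord_neg, Complex.ofReal_neg, Finset.prod_neg,
    Finset.card_univ, Fintype.card_fin, neg_mul, neg_neg]
  ring

theorem exists_unitDir_eq {ζ : ℂ} (hζ : ‖ζ‖ = 1) : ∃ θ : ℝ, unitDir (0, θ) = ζ :=
  (Complex.norm_eq_one_iff ζ).1 hζ

theorem exists_moment_polynomial_mixed {k ℓ : ℕ} (f : SchwartzTensorField k ℓ) (r : ℕ) :
    ∃ P : MvPolynomial (Fin 2) ℂ, P.IsHomogeneous (k + ℓ + r) ∧ ∀ (ζ : ℂ) (hζ : ‖ζ‖ = 1),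
      ∫ p : ℝ, (p : ℂ) ^ r * mixedRayTransform f (TangentCircle.ofParam p ζ hζ) =
        MvPolynomial.eval ![ζ, conj ζ] P := by
  choose P hP h using fun i : Fin k → Fin 2 => fun j : Fin ℓ → Fin 2 => exists_tensorWeight_poly i j
  choose Q hQ h' using fun i j => (f.1 i j).exists_moment_polynomial r
  refine ⟨∑ i, ∑ j, P i j * Q i j, .sum _ _ _ fun i _ => .sum _ _ _ fun j _ =>
    (hP i j).mul (hQ i j), fun ζ hζ => ?_⟩
  obtain ⟨θ, rfl⟩ := exists_unitDir_eq hζ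
  have hi : ∀ i j, Integrable fun p : ℝ => (p : ℂ) ^ r *
      (tensorWeight (unitDir (0, θ)) i j * rayTransform (f.1 i j) (p, θ)) := fun i j => by
    have hpow : ∀ r : ℕ, CylSchwartz fun y => (y.1 : ℂ) ^ r * rayTransform (f.1 i j) y := by
      intro r
      induction r with
      | zero => simpa using (f.1 i j).cylSchwartz_rayTransform
      | succ r ih => simpa [pow_succ', mul_assoc] using ih.fst_mul
    refine (((hpow r).integrable θ).const_mul (tensorWeight (unitDir (0, θ)) i j)).congr
      (.of_forall fun p => ?_)
    simp only
    ring
  have e : ∀ p : ℝ, (p : ℂ) ^ r * mixedRayTransform f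
      (TangentCircle.ofParam p (unitDir (0, θ)) hζ) = ∑ i, ∑ j, (p : ℂ) ^ r *
      (tensorWeight (unitDir (0, θ)) i j * rayTransform (f.1 i j) (p, θ)) := by
    intro p
    simp only [← Finset.mul_sum]
    congr 1
    exact mixedRayTransform_ofParam f (p, θ) hζ
  simp only [e]
  rw [integral_finsetSum _ fun i _ => integrable_finsetSum _ fun j _ => hi i j, map_sum]
  refine Finset.sum_congr rfl fun i _ => ?_
  rw [integral_finsetSum _ fun j _ => hi i j, map_sum]
  refine Finset.sum_congr rfl fun j _ => ?_
  rw [map_mul, ← h, ← h', ← integral_const_mul]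
  refine integral_congr_ae (.of_forall fun p => ?_)
  simp only
  ring

theorem mainTheorem6 (k ℓ : ℕ) :
    (∀ f : SchwartzTensorField k ℓ, TangentCircle.IsSchwartz (mixedRayTransform f)) ∧
    ∀ φ : TangentCircle → ℂ, TangentCircle.IsSchwartz φ →
      (φ ∈ Set.range (fun f : SchwartzTensorField k ℓ => mixedRayTransform f) ↔
        (∀ (p : ℝ) (ζ : ℂ) (hζ : ‖ζ‖ = 1),
          φ (TangentCircle.ofParam p ζ hζ).reverse =
            (-1) ^ (k + ℓ) * φ (TangentCircle.ofParam p ζ hζ)) ∧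
        (∀ r : ℕ, ∃ P : MvPolynomial (Fin 2) ℂ, P.IsHomogeneous (k + ℓ + r) ∧
          ∀ (ζ : ℂ) (hζ : ‖ζ‖ = 1),
            ∫ p : ℝ, (p : ℂ) ^ r * φ (TangentCircle.ofParam p ζ hζ) =
              MvPolynomial.eval ![ζ, conj ζ] P)) := by
  refine ⟨isSchwartz_mixedRayTransform, fun φ hφ => ⟨?_, ?_⟩⟩
  · rintro ⟨f, rfl⟩
    exact ⟨fun p ζ hζ => mixedRayTransform_reverse f _, exists_moment_polynomial_mixed f⟩
  · rintro ⟨hpar, hmom⟩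
    rw [TangentCircle.isSchwartz_iff] at hφ
    obtain ⟨a, ha⟩ := exists_eq_sum_rayTransform (k + ℓ) hφ
      (fun p θ θ' h => congrArg φ (ofParam_congr rfl h _ _))
      (fun p θ θ' h => by
        refine Eq.trans (congrArg φ ?_) (hpar p (unitDir (0, θ)) (norm_unitDir _))
        have h' : Complex.exp (θ' * Complex.I) = -unitDir (0, θ) := h
        ext1
        · simp [TangentCircle.ofParam, TangentCircle.reverse, h']
        · simp [TangentCircle.ofParam, TangentCircle.reverse, h'])
      (fun r => by
        obtain ⟨P, hP, h⟩ := hmom r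
        exact ⟨P, hP, fun θ => h _ (norm_unitDir (0, θ))⟩)
    obtain ⟨f, hf⟩ := exists_tensorField k ℓ a
    refine ⟨f, funext fun q => ?_⟩
    -- Every point of `T𝕊¹` has coordinates `(p, θ)`.
    obtain ⟨θ, hθ⟩ := exists_unitDir_eq q.norm_dir
    obtain ⟨p, rfl⟩ : ∃ p : ℝ, q = TangentCircle.ofParam p (unitDir (p, θ)) (norm_unitDir _) := by
      refine ⟨(q.base * conj q.dir).im, ?_⟩
      have hin := q.inner_base_dir
      rw [Complex.inner] at hin
      have hre : (q.base * conj q.dir).re = 0 := by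
        simp at hin ⊢; linarith
      have hb : q.base * conj q.dir = Complex.I * (q.base * conj q.dir).im := by
        apply Complex.ext <;> simp [hre]
      have hu : q.dir * conj q.dir = 1 := by rw [← hθ]; exact unitDir_mul_conj _
      ext1
      · change q.base = Complex.I * ((q.base * conj q.dir).im : ℝ) * unitDir (0, θ)
        rw [← hb, hθ]
        linear_combination (-q.base) * hu
      · exact hθ.symm
    refine (mixedRayTransform_ofParam f (p, θ) (norm_unitDir _)).trans ?_
    rw [hf, ← ha]
    rfl
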